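/- Let $(X,d)$ be a compact locally linearly connected (LLC) metric space: $X$ is a (non-empty) compact connected metric space and there is a constant $C$ such that any two distinct points $x,y\in X$ are joined by an arc of diameter at most $C\,d(x,y)$. Let $f:X\to\mathbb{R}$ be continuous, and let $k$ be a field. * $T_f$ is the metric space $X/\{d_f=0\}$ with the distance induced by the pseudo-distance $d_f(x,y)=f(x)+f(y)-2\sup_{\gamma}\inf_{t\in[0,1]}f(\gamma(t))$, the supremum running over all paths $\gamma$ in $X$ from $x$ to $y$. * $\overline{\dim}\,Y=\limsup_{\varepsilon\to0^+}\frac{\log \mathcal N_Y(\varepsilon)}{\log(1/\varepsilon)}\in[0,\infty]$ is the upper box dimension, where $\mathcal N_Y(\varepsilon)$ is the minimal number of balls of radius $\varepsilon$ that cover the non-empty metric space $Y$. * $\mathcal L_0(f)=\inf\{p\ge1 : \mathrm{Pers}_p(f)<\infty\}\in[1,\infty]$ is the persistence index, where $\mathrm{Pers}_p(f)=\big(\sum_b \ell(b\cap[\inf f,\sup f])^p\big)^{1/p}$, the sum running, with multiplicity, over the bars $b$ of the degree $0$ barcode of the superlevel filtration $X_r=\{f\ge r\}$, computed in Čech homology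 with coefficients in $k$, and $\ell$ denotes length. * $\mathcal H(f)=\inf\{1/\alpha : \alpha>0 \text{ and there is a homeomorphism } \lambda:X\to X \text{ such that } f\circ\lambda \text{ is } \alpha\text{-Hölder}\}\in[0,\infty]$. Then: 1. if $f$ is not constant, $\mathcal L_0(f)=\overline{\dim}\,T_f$ (possibly both are $\infty$); 2. $\overline{\dim}\,T_f\le\mathcal H(f)\cdot\overline{\dim}\,X$, except that nothing is asserted when $\mathcal H(f)=0$ and $\overline{\dim}\,X=\infty$, where the product is undefined. -/

import Mathlib

open Set Filter Topology
open scoped NNReal ENNReal unitInterval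

universe u v

/-! ### Locally linearly connected metric spaces -/

/-- A locally linearly connected (LLC) metric space: a connected metric space with a constant `C`
such that any two distinct points `x`, `y` are joined by an arc of diameter at most
`C * dist x y`. (The arc joining a point to itself is the constant one; any two points lie in a
common ball, so no ball has to be mentioned.) -/
class LLCSpace (X : Type u) [MetricSpace X] : Prop extends ConnectedSpace X where
  exists_arc : ∃ C : ℝ, ∀ x y : X, x ≠ y →
    ∃ γ : Path x y, Function.Injective γ ∧ Metric.diam (range γ) ≤ C * dist x y

instance LLCSpace.pathConnectedSpace (X : Type u) [MetricSpace X] [h : LLCSpace X] :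
    PathConnectedSpace X where
  nonempty := inferInstance
  joined x y := by
    obtain ⟨C, hC⟩ := h.exists_arc
    by_cases hxy : x = y
    · subst hxy; exact Joined.refl x
    · obtain ⟨γ, -⟩ := hC x y hxy; exact ⟨γ⟩

/-! ### Upper box dimension -/

/-- The upper box dimension `limsup_{ε → 0⁺} log N(ε) / log (1 / ε)`, in `[0, ∞]`, where `N(ε)` is
the minimal number of balls of radius `ε` needed to cover `Y`. -/
noncomputable def upperBoxDim (Y : Type u) [PseudoMetricSpace Y] : ℝ≥0∞ :=
  limsup (fun ε : ℝ≥0 =>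
    (ENNReal.log ((Metric.coveringNumber ε (univ : Set Y) : ℕ∞) : ℝ≥0∞) /
      ((Real.log (1 / (ε : ℝ)) : ℝ) : EReal)).toENNReal) (𝓝[>] 0)

/-! ### The tree of a continuous function -/

section Tree

variable {X : Type u} [TopologicalSpace X]

/-- `sup_γ inf_t f (γ t)`, the supremum running over all paths `γ` from `x` to `y`. -/
noncomputable def passLevel (f : C(X, ℝ)) (x y : X) : ℝ :=
  ⨆ γ : Path x y, ⨅ t : I, f (γ t)

/-- The `H₀`-distance `d_f (x, y) = f x + f y - 2 sup_γ inf_t f (γ t)`. -/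
noncomputable def h0Dist (f : C(X, ℝ)) (x y : X) : ℝ :=
  f x + f y - 2 * passLevel f x y

theorem path_inf_le (f : C(X, ℝ)) {x y : X} (γ : Path x y) (t : I) :
    ⨅ t : I, f (γ t) ≤ f (γ t) :=
  ciInf_le (isCompact_range (f.continuous.comp γ.continuous)).bddBelow t

theorem passLevel_bddAbove (f : C(X, ℝ)) (x y : X) :
    BddAbove (range fun γ : Path x y => ⨅ t : I, f (γ t)) := by
  refine ⟨f x, ?_⟩
  rintro _ ⟨γ, rfl⟩
  simpa using path_inf_le f γ 0

theorem le_passLevel (f : C(X, ℝ)) {x y : X} (γ : Path x y) :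
    ⨅ t : I, f (γ t) ≤ passLevel f x y :=
  le_ciSup (passLevel_bddAbove f x y) γ

theorem passLevel_symm_le (f : C(X, ℝ)) [PathConnectedSpace X] (x y : X) :
    passLevel f x y ≤ passLevel f y x := by
  have : Nonempty (Path x y) := PathConnectedSpace.joined x y
  refine ciSup_le fun γ => le_trans (le_ciInf fun t => ?_) (le_passLevel f γ.symm)
  exact path_inf_le f γ (unitInterval.symm t)

theorem passLevel_le_left (f : C(X, ℝ)) [PathConnectedSpace X] (x y : X) :
    passLevel f x y ≤ f x := by
  have : Nonempty (Path x y) := PathConnectedSpace.joined x y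
  exact ciSup_le fun γ => by simpa using path_inf_le f γ 0

theorem passLevel_self (f : C(X, ℝ)) [PathConnectedSpace X] (x : X) :
    passLevel f x x = f x := by
  refine le_antisymm (passLevel_le_left f x x) ?_
  simpa using le_passLevel f (Path.refl x)

theorem min_passLevel_le (f : C(X, ℝ)) [PathConnectedSpace X] (x y z : X) :
    min (passLevel f x y) (passLevel f y z) ≤ passLevel f x z := by
  have : Nonempty (Path x y) := PathConnectedSpace.joined x y
  have : Nonempty (Path y z) := PathConnectedSpace.joined y z
  refine le_of_forall_lt fun c hc => ?_
  obtain ⟨h1, h2⟩ := lt_min_iff.1 hc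
  obtain ⟨γ, hγ⟩ := exists_lt_of_lt_ciSup h1
  obtain ⟨η, hη⟩ := exists_lt_of_lt_ciSup h2
  refine lt_of_lt_of_le (lt_min hγ hη) (le_trans (le_ciInf fun t => ?_) (le_passLevel f (γ.trans η)))
  have ht : (γ.trans η) t ∈ range γ ∪ range η := by
    rw [← Path.trans_range]; exact mem_range_self t
  rcases ht with ⟨s, hs⟩ | ⟨s, hs⟩
  · rw [← hs]; exact (min_le_left _ _).trans (path_inf_le f γ s)
  · rw [← hs]; exact (min_le_right _ _).trans (path_inf_le f η s)

/-- The set `X` viewed as a pseudometric space with the pseudo-distance `d_f`. -/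
def H0Space (_f : C(X, ℝ)) : Type u := X

noncomputable instance H0Space.instPseudoMetricSpace [PathConnectedSpace X] (f : C(X, ℝ)) :
    PseudoMetricSpace (H0Space f) where
  dist x y := h0Dist (X := X) f x y
  dist_self x := by
    have h := passLevel_self (X := X) f x
    simp only [h0Dist, h]; ring
  dist_comm x y := by
    simp only [h0Dist,
      le_antisymm (passLevel_symm_le (X := X) f x y) (passLevel_symm_le (X := X) f y x)]
    ring
  dist_triangle x y z := by
    have h1 := min_passLevel_le (X := X) f x y z
    have h2 := passLevel_le_left (X := X) f y z
    have h3 := (passLevel_symm_le (X := X) f x y).trans (passLevel_le_left (X := X) f y x)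
    simp only [h0Dist]
    rcases min_choice (passLevel (X := X) f x y) (passLevel (X := X) f y z) with h | h <;>
      rw [h] at h1 <;> linarith

/-- The tree `T_f = X / {d_f = 0}`, a metric space with the distance induced by `d_f`. -/
abbrev H0Tree (f : C(X, ℝ)) [PathConnectedSpace X] : Type u := SeparationQuotient (H0Space f)

end Tree

/-! ### Čech homology in degree zero -/

/-- An (indexed) open cover of a topological space. -/
structure CechCover (Y : Type u) [TopologicalSpace Y] where
  ι : Type u
  U : ι → Set Y
  isOpen : ∀ i, IsOpen (U i)
  iUnion_eq : ⋃ i, U i = univ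

namespace CechCover

variable {Y Z : Type u} [TopologicalSpace Y] [TopologicalSpace Z] (k : Type v) [Field k]

/-- The vertices of the nerve of a cover: the indices of its nonempty members. -/
def Vertex (𝒰 : CechCover Y) : Type u := {i : 𝒰.ι // (𝒰.U i).Nonempty}

/-- The member of the cover that belongs to a vertex of the nerve. -/
def cell (𝒰 : CechCover Y) (i : 𝒰.Vertex) : Set Y := 𝒰.U i.1

/-- The degree zero boundaries of the nerve: the span of the boundaries `[j] - [i]` of its edges,
where `i`, `j` span an edge if the corresponding members of the cover meet. -/
noncomputable def boundaries (𝒰 : CechCover Y) : Submodule k (𝒰.Vertex →₀ k) :=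
  Submodule.span k {c | ∃ i j : 𝒰.Vertex, (𝒰.cell i ∩ 𝒰.cell j).Nonempty ∧
    c = Finsupp.single j 1 - Finsupp.single i 1}

/-- Degree zero simplicial homology of the nerve, with coefficients in `k`. -/
abbrev NerveH0 (𝒰 : CechCover Y) : Type (max u v) := (𝒰.Vertex →₀ k) ⧸ 𝒰.boundaries k

theorem boundaries_le_comap {𝒱 : CechCover Y} {𝒰 : CechCover Z} (φ : 𝒱.Vertex → 𝒰.Vertex)
    (g : C(Y, Z)) (h : ∀ i, MapsTo g (𝒱.cell i) (𝒰.cell (φ i))) :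
    𝒱.boundaries k ≤ (𝒰.boundaries k).comap (Finsupp.lmapDomain k k φ) := by
  refine Submodule.span_le.2 ?_
  rintro _ ⟨i, j, ⟨y, hi, hj⟩, rfl⟩
  refine Submodule.subset_span ⟨φ i, φ j, ⟨g y, h i hi, h j hj⟩, ?_⟩
  rw [map_sub]; simp [Finsupp.lmapDomain_apply, Finsupp.mapDomain_single]

/-- The map induced on degree zero homology of nerves by a vertex map `φ` that lies over a
continuous map `g` (over the identity, such a `φ` is a refinement map). -/
noncomputable def push {𝒱 : CechCover Y} {𝒰 : CechCover Z} (φ : 𝒱.Vertex → 𝒰.Vertex)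
    (g : C(Y, Z)) (h : ∀ i, MapsTo g (𝒱.cell i) (𝒰.cell (φ i))) :
    𝒱.NerveH0 k →ₗ[k] 𝒰.NerveH0 k :=
  Submodule.mapQ _ _ (Finsupp.lmapDomain k k φ) (boundaries_le_comap k φ g h)

theorem push_push {W : Type u} [TopologicalSpace W] {𝒲 : CechCover W} {𝒱 : CechCover Y}
    {𝒰 : CechCover Z} (φ : 𝒲.Vertex → 𝒱.Vertex) (g : C(W, Y))
    (h : ∀ i, MapsTo g (𝒲.cell i) (𝒱.cell (φ i))) (ψ : 𝒱.Vertex → 𝒰.Vertex) (g' : C(Y, Z))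
    (h' : ∀ i, MapsTo g' (𝒱.cell i) (𝒰.cell (ψ i))) (c : 𝒲.NerveH0 k) :
    push k ψ g' h' (push k φ g h c)
      = push k (ψ ∘ φ) (g'.comp g) (fun i _ hx => h' (φ i) (h i hx)) c := by
  induction c using Submodule.Quotient.induction_on with
  | H c =>
    simp only [push, Submodule.mapQ_apply, Finsupp.lmapDomain_apply, ← Finsupp.mapDomain_comp]

/-- The cover of `Y` by the preimages under `g : Y → Z` of the members of a cover of `Z`. -/
def pullback (g : C(Y, Z)) (𝒰 : CechCover Z) : CechCover Y where
  ι := 𝒰.ι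
  U i := g ⁻¹' 𝒰.U i
  isOpen i := (𝒰.isOpen i).preimage g.continuous
  iUnion_eq := by rw [← preimage_iUnion, 𝒰.iUnion_eq, preimage_univ]

/-- The inclusion of the vertices of the nerve of a preimage cover. -/
def pullbackVertex (g : C(Y, Z)) (𝒰 : CechCover Z) (i : (𝒰.pullback g).Vertex) : 𝒰.Vertex :=
  ⟨i.1, i.2.elim fun y hy => ⟨g y, hy⟩⟩

theorem mapsTo_pullbackVertex (g : C(Y, Z)) (𝒰 : CechCover Z) (i : (𝒰.pullback g).Vertex) :
    MapsTo g ((𝒰.pullback g).cell i) (𝒰.cell (𝒰.pullbackVertex g i)) := fun _ hy => hy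

end CechCover

/-- Degree zero Čech homology of `Y` with coefficients in `k`: the inverse limit, over all open
covers of `Y` and all refinement maps, of the degree zero homology of the nerves. -/
noncomputable def CechH0 (k : Type v) [Field k] (Y : Type u) [TopologicalSpace Y] :
    Submodule k (∀ 𝒰 : CechCover Y, 𝒰.NerveH0 k) where
  carrier := {c | ∀ (𝒰 𝒱 : CechCover Y) (φ : 𝒱.Vertex → 𝒰.Vertex)
    (h : ∀ i, MapsTo (ContinuousMap.id Y) (𝒱.cell i) (𝒰.cell (φ i))),
    CechCover.push k φ (ContinuousMap.id Y) h (c 𝒱) = c 𝒰}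
  add_mem' ha hb 𝒰 𝒱 φ h := by
    simp only [Pi.add_apply, map_add, ha 𝒰 𝒱 φ h, hb 𝒰 𝒱 φ h]
  zero_mem' _ _ _ _ := by simp
  smul_mem' r c hc 𝒰 𝒱 φ h := by
    simp only [Pi.smul_apply, map_smul, hc 𝒰 𝒱 φ h]

/-- The map induced on degree zero Čech homology by a continuous map `g : Y → Z`: the component
at a cover `𝒰` of `Z` is the image of the component at the cover `g⁻¹ 𝒰` of `Y`. -/
noncomputable def CechH0.map (k : Type v) [Field k] {Y Z : Type u} [TopologicalSpace Y] [TopologicalSpace Z]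
    (g : C(Y, Z)) : CechH0 k Y →ₗ[k] CechH0 k Z where
  toFun c := ⟨fun 𝒰 => CechCover.push k (𝒰.pullbackVertex g) g (𝒰.mapsTo_pullbackVertex g)
      (c.1 (𝒰.pullback g)), by
    intro 𝒰 𝒱 φ h
    have h' : ∀ (i : (𝒱.pullback g).Vertex) (y : Y), g y ∈ 𝒱.U i.1 →
        g y ∈ 𝒰.U (φ (𝒱.pullbackVertex g i)).1 := fun i y hy => h (𝒱.pullbackVertex g i) hy
    let ψ : (𝒱.pullback g).Vertex → (𝒰.pullback g).Vertex := fun i =>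
      ⟨(φ (𝒱.pullbackVertex g i)).1, i.2.imp fun y hy => h' i y hy⟩
    have hψ : ∀ i, MapsTo (ContinuousMap.id Y) ((𝒱.pullback g).cell i)
        ((𝒰.pullback g).cell (ψ i)) := fun i y hy => h' i y hy
    have key := c.2 (𝒰.pullback g) (𝒱.pullback g) ψ hψ
    dsimp only
    refine Eq.trans ?_ (congrArg _ key)
    rw [CechCover.push_push, CechCover.push_push]
    rfl⟩
  map_add' a b := by
    ext 𝒰; simp
  map_smul' r a := by
    ext 𝒰; simp

/-! ### The degree zero barcode of the superlevel filtration -/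

/-- The superlevel set `X_r = {x | r ≤ f x}`. -/
def superlevel {X : Type u} [TopologicalSpace X] (f : C(X, ℝ)) (r : ℝ) : Set X := {x | r ≤ f x}

theorem superlevel_anti {X : Type u} [TopologicalSpace X] (f : C(X, ℝ)) {r s : ℝ} (h : s ≤ r) :
    superlevel f r ⊆ superlevel f s := fun _ hx => le_trans h hx

open Classical in
/-- For `s ≤ r`, the rank of `H₀(X_r) → H₀(X_s)` (Čech homology over `k`). -/
noncomputable def superlevelRank (k : Type v) [Field k] {X : Type u} [TopologicalSpace X]
    (f : C(X, ℝ)) (r s : ℝ) : ℕ :=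
  if h : s ≤ r then
    Module.finrank k
      (LinearMap.range (CechH0.map k (ContinuousMap.inclusion (superlevel_anti f h))))
  else 0

/-- Given the rank function `ρ r s` (`s ≤ r`) of a q-tame persistence module indexed by decreasing
reals, the multiplicity in its barcode of the bars born at `β` that die at the finite level
`δ < β`. The number of bars with birth between `r₁` and `r₂` and death between `s₁` and `s₂` is
`ρ r₁ s₂ - ρ r₂ s₂ - ρ r₁ s₁ + ρ r₂ s₁`, and the multiplicity of the point `(β, δ)` is the minimum
of this number over all rectangles around the point that avoid the diagonal. It is `0` if
`β ≤ δ`, where there are no such rectangles. -/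
noncomputable def barMult (ρ : ℝ → ℝ → ℕ) (β δ : ℝ) : ℕ :=
  sInf {n : ℕ | ∃ s₁ s₂ r₁ r₂ : ℝ, s₁ < δ ∧ δ < s₂ ∧ s₂ < r₁ ∧ r₁ < β ∧ β < r₂ ∧
    (n : ℤ) = ρ r₁ s₂ - ρ r₂ s₂ - ρ r₁ s₁ + ρ r₂ s₁}

/-- As `barMult`, for the bars born at `β` that never die (death level `-∞`): the number of bars
with birth between `r₁` and `r₂` that are still alive at level `s` is `ρ r₁ s - ρ r₂ s`. -/
noncomputable def essentialBarMult (ρ : ℝ → ℝ → ℕ) (β : ℝ) : ℕ :=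
  sInf {n : ℕ | ∃ s r₁ r₂ : ℝ, s < r₁ ∧ r₁ < β ∧ β < r₂ ∧ (n : ℤ) = ρ r₁ s - ρ r₂ s}

/-- `Pers_p (H₀(X, f)) = (∑_b ℓ(b ∩ [inf f, sup f]) ^ p) ^ (1 / p)`, in `[0, ∞]`, the sum running
over the bars of the degree zero barcode of the superlevel filtration, with multiplicity. -/
noncomputable def pers (k : Type v) [Field k] {X : Type u} [TopologicalSpace X]
    (f : C(X, ℝ)) (p : ℝ) : ℝ≥0∞ :=
  ((∑' b : ℝ × ℝ, (barMult (superlevelRank k f) b.1 b.2 : ℝ≥0∞) *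
        ENNReal.ofReal (min b.1 (⨆ x, f x) - max b.2 (⨅ x, f x)) ^ p) +
    ∑' β : ℝ, (essentialBarMult (superlevelRank k f) β : ℝ≥0∞) *
        ENNReal.ofReal (min β (⨆ x, f x) - ⨅ x, f x) ^ p) ^ (1 / p)

/-- The persistence index `𝓛₀(f) = inf {p ≥ 1 | Pers_p (H₀(X, f)) < ∞}`, in `[1, ∞]`. -/
noncomputable def persIndex (k : Type v) [Field k] {X : Type u} [TopologicalSpace X]
    (f : C(X, ℝ)) : ℝ≥0∞ :=
  ⨅ (p : ℝ) (_ : 1 ≤ p) (_ : pers k f p < ⊤), ENNReal.ofReal p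

/-! ### The Hölder index -/

/-- `𝓗(f) = inf {1 / α | ∃ λ ∈ Homeo(X), f ∘ λ is α-Hölder}`, in `[0, ∞]`, over all `α > 0`. -/
noncomputable def holderIndex {X : Type u} [MetricSpace X] (f : C(X, ℝ)) : ℝ≥0∞ :=
  ⨅ (α : ℝ≥0) (_ : 0 < α) (_ : ∃ (e : X ≃ₜ X) (K : ℝ≥0), HolderWith K α (f ∘ e)),
    1 / (α : ℝ≥0∞)

/-! ### Passing levels and connected components of superlevel sets -/

section PassLevel

variable {X : Type u} [MetricSpace X]

/-! Both statements rest on the passing level of two points, the height up to which paths keep them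
together. Since `X` is LLC and compact, `s ≤ passLevel f x y` holds exactly when `x` and `y` lie in
one component of the superlevel set `X_s`. Hence a finite set of representatives of the components
of `X_s` that meet `X_r` (a transversal) gives a basis of the image of `H₀(X_r) → H₀(X_s)`, and
`superlevelRank` counts such components (`IsTransversal.superlevelRank_eq`). The elder rule
(`exists_bars`) turns these ranks into bars.

For the first statement, cut `[inf f, sup f]` into steps of length `ε` and add up the ranks between
consecutive levels; this is `gridRank`. It lies between two covering numbers of the tree: `N(4ε) ≤
gridRank + 1` and `gridRank ≤ N(ε/3)`. It is also controlled by the bars. A bar longer than `2ε`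
contains a whole step, so there are at most `gridRank` finite bars of that length. Conversely, a bar
counted in `n` steps has length at least `nε`, and `n ε^p ≤ (nε)^p` for `p ≥ 1`, so `gridRank * ε^p`
is at most the `p`-th power sum of the bars plus a bounded term. Summation over dyadic lengths then
makes the two exponents agree. The infimum over `p ≥ 1` loses nothing, because the tree of a
nonconstant `f` has dimension at least `1`.

For the second statement, LLC arcs show that if `f ∘ e` is `α`-Hölder, then so is the surjection `x
↦ [e x]` from `X` to `T_f`; such a map multiplies the box dimension by at most `1/α`. -/

theorem LLCSpace.exists_path_dist_le [h : LLCSpace X] :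
    ∃ C : ℝ, 1 ≤ C ∧ ∀ x y : X, ∃ γ : Path x y, ∀ t, dist x (γ t) ≤ C * dist x y := by
  obtain ⟨C, hC⟩ := h.exists_arc
  -- A constant at least `1` is positive, and balls of radius `C * dist x y` about `x` contain `y`.
  refine ⟨max C 1, le_max_right _ _, fun x y => ?_⟩
  by_cases hxy : x = y
  · subst hxy
    exact ⟨Path.refl x, fun t => by simp⟩
  · obtain ⟨γ, -, hγ⟩ := hC x y hxy
    refine ⟨γ, fun t => ?_⟩
    have h1 : dist x (γ t) ≤ Metric.diam (range γ) :=
      Metric.dist_le_diam_of_mem (isCompact_range γ.continuous).isBounded ⟨0, γ.source⟩ ⟨t, rfl⟩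
    exact h1.trans (hγ.trans (mul_le_mul_of_nonneg_right (le_max_left _ _) dist_nonneg))

variable [LLCSpace X] (f : C(X, ℝ))

theorem passLevel_comm (x y : X) : passLevel f x y = passLevel f y x :=
  le_antisymm (passLevel_symm_le f x y) (passLevel_symm_le f y x)

theorem passLevel_le_right (x y : X) : passLevel f x y ≤ f y := by
  rw [passLevel_comm]; exact passLevel_le_left f y x

variable {f} in
theorem le_passLevel_trans {s : ℝ} {x y z : X} (h1 : s ≤ passLevel f x y)
    (h2 : s ≤ passLevel f y z) : s ≤ passLevel f x z :=
  (le_min h1 h2).trans (min_passLevel_le f x y z)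

/-- Near `x` the LLC paths stay in a ball on which `f > c`. This is the local connectedness behind
all that follows. -/
theorem eventually_le_passLevel {c : ℝ} {x : X} (hc : c < f x) :
    ∀ᶠ y in 𝓝 x, c ≤ passLevel f x y := by
  obtain ⟨C, hC1, hC⟩ := LLCSpace.exists_path_dist_le (X := X)
  have h1 : ∀ᶠ y in 𝓝 x, c < f y := f.continuous.continuousAt.eventually (lt_mem_nhds hc)
  obtain ⟨ε, hε, hball⟩ := Metric.eventually_nhds_iff.1 h1
  have hC0 : 0 < C := by linarith
  refine Metric.eventually_nhds_iff.2 ⟨ε / C, by positivity, fun y hy => ?_⟩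
  obtain ⟨γ, hγ⟩ := hC x y
  refine le_trans (le_ciInf fun t => ?_) (le_passLevel f γ)
  refine (hball ?_).le
  rw [dist_comm]
  refine (hγ t).trans_lt ?_
  rw [dist_comm] at hy
  rw [lt_div_iff₀ hC0] at hy
  linarith

/-- For `c < s`, having passing level at least `c` is an equivalence relation on `K` with relatively
open classes, so a connected `K` has only one class. Then let `c` tend to `s`. -/
theorem le_passLevel_of_isPreconnected {K : Set X} (hK : IsPreconnected K) {s : ℝ}
    (hs : ∀ z ∈ K, s ≤ f z) {x y : X} (hx : x ∈ K) (hy : y ∈ K) : s ≤ passLevel f x y := by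
  refine le_of_forall_lt_imp_le_of_dense fun c hc => ?_
  refine hK.induction₂ (fun a b => c ≤ passLevel f a b) (fun a ha => ?_)
    (fun a b d _ _ _ => le_passLevel_trans) (fun a b _ _ h => ?_) hx hy
  · exact (eventually_le_passLevel f (hc.trans_le (hs a ha))).filter_mono nhdsWithin_le_nhds
  · rwa [passLevel_comm]

theorem isClosed_setOf_le_passLevel (s : ℝ) (x : X) : IsClosed {y | s ≤ passLevel f x y} := by
  refine isClosed_iff_frequently.2 fun y hy => ?_
  change s ≤ passLevel f x y
  refine le_of_forall_lt_imp_le_of_dense fun c hc => ?_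
  have hfy : s ≤ f y := by
    have hcl : IsClosed {z | s ≤ f z} := isClosed_le continuous_const f.continuous
    exact isClosed_iff_frequently.1 hcl y
      (hy.mono fun z (hz : s ≤ _) => hz.trans (passLevel_le_right f x z))
  obtain ⟨z, hz, hz'⟩ := (hy.and_eventually (eventually_le_passLevel f (hc.trans_le hfy))).exists
  rw [passLevel_comm] at hz'
  exact le_passLevel_trans (hc.le.trans hz) hz'

theorem iInf_le_passLevel [CompactSpace X] (x y : X) : ⨅ z, f z ≤ passLevel f x y :=
  le_passLevel_of_isPreconnected f isPreconnected_univ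
    (fun z _ => ciInf_le (isCompact_range f.continuous).bddBelow z) (mem_univ x) (mem_univ y)

/-- A path descending from `x` to a point below the level `h` crosses that level. -/
theorem exists_eq_and_le_passLevel {h : ℝ} {x z : X} (hx : h ≤ f x) (hz : f z ≤ h) :
    ∃ y, f y = h ∧ h ≤ passLevel f x y := by
  obtain ⟨γ⟩ : Nonempty (Path x z) := PathConnectedSpace.joined x z
  have hcont : Continuous fun t : ℝ => f (γ.extend t) := f.continuous.comp γ.continuous_extend
  have hcpt : IsCompact (Icc (0 : ℝ) 1 ∩ {t | f (γ.extend t) ≤ h}) :=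
    isCompact_Icc.inter_right (isClosed_le hcont continuous_const)
  -- `τ` is the first time at which the path is at level `h` or below; by the intermediate value
  -- theorem it cannot have dropped below `h` by then.
  obtain ⟨τ, ⟨⟨hτ0, hτ1⟩, hτ⟩, hleast⟩ := hcpt.exists_isLeast ⟨1, by simp, by simpa using hz⟩
  have hge : ∀ t ∈ Icc 0 τ, h ≤ f (γ.extend t) := by
    intro t ht
    by_contra! hlt
    obtain ⟨t', ht', he⟩ := intermediate_value_Icc' ht.1 hcont.continuousOn
      ⟨hlt.le, by simpa using hx⟩
    have h2 : τ ≤ t' := hleast ⟨⟨ht'.1, ht'.2.trans (ht.2.trans hτ1)⟩, le_of_eq he⟩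
    have h3 : t = t' := le_antisymm (ht.2.trans h2) ht'.2
    subst h3
    exact hlt.ne he
  refine ⟨γ.extend τ, le_antisymm hτ (hge τ ⟨hτ0, le_rfl⟩), ?_⟩
  refine le_passLevel_of_isPreconnected f
    (K := γ.extend '' Icc 0 τ) (isPreconnected_Icc.image _ γ.continuous_extend.continuousOn) ?_
    ⟨0, ⟨le_rfl, hτ0⟩, by simp⟩ ⟨τ, ⟨hτ0, le_rfl⟩, rfl⟩
  rintro _ ⟨t, ht, rfl⟩
  exact hge t ht

variable {f} in
-- The supremum defining the passing level need not be attained, so paths may dip slightly below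
-- `s`. But `K` and its complement in `X_s` have disjoint open neighbourhoods in `X`, outside of
-- which `f` stays below some `c < s`. A path that stays above `c` cannot switch neighbourhoods.
theorem mem_of_isClopen_of_le_passLevel [CompactSpace X] {s : ℝ} {K : Set (superlevel f s)}
    (hK : IsClopen K) {x y : superlevel f s} (hx : x ∈ K) (h : s ≤ passLevel f x.1 y.1) :
    y ∈ K := by
  by_contra hy
  have hcl : IsClosed (superlevel f s) := isClosed_le continuous_const f.continuous
  have hemb := hcl.isClosedEmbedding_subtypeVal
  have hdisj : Disjoint (Subtype.val '' K : Set X) (Subtype.val '' Kᶜ) :=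
    (disjoint_image_iff Subtype.val_injective).2 disjoint_compl_right
  obtain ⟨U, V, hU, hV, hKU, hKV, hUV⟩ := SeparatedNhds.of_isCompact_isCompact
    (hemb.isClosedMap _ hK.isClosed).isCompact
    (hemb.isClosedMap _ hK.compl.isClosed).isCompact hdisj
  have hZ : IsCompact (U ∪ V)ᶜ := (hU.union hV).isClosed_compl.isCompact
  have hlt : ∀ z ∈ (U ∪ V)ᶜ, f z < s := by
    intro z hz
    by_contra! hzs
    refine hz ?_
    by_cases hzK : (⟨z, hzs⟩ : superlevel f s) ∈ K
    · exact Or.inl (hKU ⟨_, hzK, rfl⟩)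
    · exact Or.inr (hKV ⟨_, hzK, rfl⟩)
  obtain ⟨c, hcs, hc⟩ : ∃ c < s, ∀ z ∈ (U ∪ V)ᶜ, f z < c := by
    rcases (U ∪ V)ᶜ.eq_empty_or_nonempty with he | hne
    · exact ⟨s - 1, by linarith, by simp [he]⟩
    · obtain ⟨z, hz, hmax⟩ := hZ.exists_isMaxOn hne f.continuous.continuousOn
      obtain ⟨c, h1, h2⟩ := exists_between (hlt z hz)
      exact ⟨c, h2, fun w hw => (hmax hw).trans_lt h1⟩
  have : Nonempty (Path x.1 y.1) := PathConnectedSpace.joined _ _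
  obtain ⟨γ, hγ⟩ := exists_lt_of_lt_ciSup (hcs.trans_le h)
  have hsub : range γ ⊆ U ∪ V := by
    rintro _ ⟨t, rfl⟩
    by_contra hz
    exact absurd (hc _ hz) (not_lt.2 (hγ.le.trans (path_inf_le f γ t)))
  have hpre : IsPreconnected (range γ) := isPreconnected_range γ.continuous
  have hU' := hpre.subset_left_of_subset_union hU hV hUV hsub
    ⟨x, ⟨0, γ.source⟩, hKU ⟨x, hx, rfl⟩⟩
  exact disjoint_left.1 hUV (hU' ⟨1, γ.target⟩) (hKV ⟨y, hy, rfl⟩)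

variable {f} in
-- A common component would force passing level at least `s`; in a compact Hausdorff space
-- components are intersections of clopen sets.
theorem exists_isClopen_of_passLevel_lt [CompactSpace X] {s : ℝ} {x y : superlevel f s}
    (h : passLevel f x.1 y.1 < s) : ∃ K : Set (superlevel f s), IsClopen K ∧ x ∈ K ∧ y ∉ K := by
  have hcl : IsClosed (superlevel f s) := isClosed_le continuous_const f.continuous
  have : CompactSpace (superlevel f s) := isCompact_iff_compactSpace.1 hcl.isCompact
  have hy : y ∉ connectedComponent x := by
    intro hy
    refine absurd (le_passLevel_of_isPreconnected f (s := s)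
      (isPreconnected_connectedComponent.image Subtype.val continuous_subtype_val.continuousOn)
      ?_ ⟨x, mem_connectedComponent, rfl⟩ ⟨y, hy, rfl⟩) (not_le.2 h)
    rintro _ ⟨z, -, rfl⟩
    exact z.2
  rw [connectedComponent_eq_iInter_isClopen] at hy
  simp only [mem_iInter, not_forall] at hy
  obtain ⟨⟨K, hK, hxK⟩, hyK⟩ := hy
  exact ⟨K, hK, hxK, hyK⟩

variable {f} in
theorem mem_connectedComponent_of_le_passLevel [CompactSpace X] {s : ℝ} {x y : superlevel f s}
    (h : s ≤ passLevel f x.1 y.1) : y ∈ connectedComponent x := by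
  have hcl : IsClosed (superlevel f s) := isClosed_le continuous_const f.continuous
  have : CompactSpace (superlevel f s) := isCompact_iff_compactSpace.1 hcl.isCompact
  rw [connectedComponent_eq_iInter_isClopen, mem_iInter]
  exact fun K => mem_of_isClopen_of_le_passLevel K.2.1 K.2.2 h

end PassLevel

/-! ### Transversals -/

section Transversal

variable {X : Type u} [MetricSpace X]

/-- A finite set of representatives of the components of `X_s` that meet `X_r`. -/
structure IsTransversal (f : C(X, ℝ)) (r s : ℝ) (T : Finset X) : Prop where
  le : ∀ t ∈ T, r ≤ f t
  lt : ∀ t ∈ T, ∀ t' ∈ T, t ≠ t' → passLevel f t t' < s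
  exists_le : ∀ x, r ≤ f x → ∃ t ∈ T, s ≤ passLevel f x t

open Classical in
-- Finiteness needs `s < r`: each class at level `s` is then a neighbourhood of its points in the
-- compact set `X_r`. Representatives are taken at the maximum of `f` on their class, so that `f t`
-- is the birth of the class.
theorem exists_isTransversal [CompactSpace X] [LLCSpace X] (f : C(X, ℝ)) {r s : ℝ} (h : s < r) :
    ∃ T : Finset X, IsTransversal f r s T ∧
      ∀ t ∈ T, ∀ x, s ≤ passLevel f x t → f x ≤ f t := by
  have hr : IsCompact {x | r ≤ f x} := (isClosed_le continuous_const f.continuous).isCompact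
  obtain ⟨F, hF, hcover⟩ := hr.elim_nhds_subcover (fun x => {y | s ≤ passLevel f x y})
    fun x hx => eventually_le_passLevel f (h.trans_le hx)
  -- The representative is a function of the class as a set, so that equal classes get equal
  -- representatives.
  have hrep : ∀ A : Set X, ∃ a, (IsCompact A → A.Nonempty → a ∈ A ∧ ∀ x ∈ A, f x ≤ f a) := by
    intro A
    by_cases hA : IsCompact A ∧ A.Nonempty
    · obtain ⟨a, ha, hmax⟩ := hA.1.exists_isMaxOn hA.2 f.continuous.continuousOn
      exact ⟨a, fun _ _ => ⟨ha, fun x hx => hmax hx⟩⟩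
    · exact ⟨Classical.arbitrary X, fun h1 h2 => absurd ⟨h1, h2⟩ hA⟩
  choose rep hrep using hrep
  let cls : X → Set X := fun x => {y | s ≤ passLevel f x y}
  have hself : ∀ x, r ≤ f x → x ∈ cls x := fun x hx =>
    (h.le.trans hx).trans (passLevel_self f x).ge
  have key : ∀ x, r ≤ f x → rep (cls x) ∈ cls x ∧ ∀ y ∈ cls x, f y ≤ f (rep (cls x)) :=
    fun x hx => hrep _ (isClosed_setOf_le_passLevel f s x).isCompact ⟨x, hself x hx⟩
  have hsymm : ∀ {x y}, s ≤ passLevel f x y → s ≤ passLevel f y x := fun {x y} hxy =>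
    hxy.trans (passLevel_comm f x y).le
  refine ⟨F.image fun x => rep (cls x), ⟨?_, ?_, ?_⟩, ?_⟩
  · simp only [Finset.mem_image]
    rintro _ ⟨x, hx, rfl⟩
    exact (hF x hx).trans ((key x (hF x hx)).2 x (hself x (hF x hx)))
  · simp only [Finset.mem_image]
    rintro _ ⟨x, hx, rfl⟩ _ ⟨y, hy, rfl⟩ hne
    by_contra! hle
    refine hne (congrArg rep ?_)
    have hxy : s ≤ passLevel f x y :=
      le_passLevel_trans (key x (hF x hx)).1 (le_passLevel_trans hle (hsymm (key y (hF y hy)).1))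
    ext z
    exact ⟨fun hz => le_passLevel_trans (hsymm hxy) hz, fun hz => le_passLevel_trans hxy hz⟩
  · intro x hx
    obtain ⟨y, hy, hyx⟩ := mem_iUnion₂.1 (hcover hx)
    exact ⟨_, Finset.mem_image_of_mem _ hy, le_passLevel_trans (hsymm hyx) (key y (hF y hy)).1⟩
  · simp only [Finset.mem_image]
    rintro _ ⟨x, hx, rfl⟩ y hy
    exact (key x (hF x hx)).2 y (le_passLevel_trans (key x (hF x hx)).1 (hsymm hy))

end Transversal

/-! ### Point classes in degree zero Čech homology -/

section Cech

variable {Y Z : Type u} [TopologicalSpace Y] [TopologicalSpace Z] (k : Type v) [Field k]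

namespace CechCover

/-- The homology class of a vertex of the nerve. -/
noncomputable def vertexClass (𝒰 : CechCover Y) (i : 𝒰.Vertex) : 𝒰.NerveH0 k :=
  Submodule.Quotient.mk (Finsupp.single i 1)

theorem vertexClass_eq (𝒰 : CechCover Y) {i j : 𝒰.Vertex} {y : Y} (hi : y ∈ 𝒰.cell i)
    (hj : y ∈ 𝒰.cell j) : 𝒰.vertexClass k i = 𝒰.vertexClass k j :=
  (Submodule.Quotient.eq _).2 (Submodule.subset_span ⟨j, i, ⟨y, hj, hi⟩, rfl⟩)

theorem push_vertexClass {𝒱 : CechCover Y} {𝒰 : CechCover Z} (φ : 𝒱.Vertex → 𝒰.Vertex)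
    (g : C(Y, Z)) (h : ∀ i, MapsTo g (𝒱.cell i) (𝒰.cell (φ i))) (i : 𝒱.Vertex) :
    push k φ g h (𝒱.vertexClass k i) = 𝒰.vertexClass k (φ i) := by
  simp [push, vertexClass, Finsupp.lmapDomain_apply, Finsupp.mapDomain_single]

theorem exists_mem_cell (𝒰 : CechCover Y) (y : Y) : ∃ i : 𝒰.Vertex, y ∈ 𝒰.cell i := by
  have hy : y ∈ ⋃ i, 𝒰.U i := by rw [𝒰.iUnion_eq]; trivial
  obtain ⟨i, hi⟩ := mem_iUnion.1 hy
  exact ⟨⟨i, y, hi⟩, hi⟩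

/-- A vertex whose cell contains a given point. -/
noncomputable def pointVertex (𝒰 : CechCover Y) (y : Y) : 𝒰.Vertex :=
  (𝒰.exists_mem_cell y).choose

theorem mem_cell_pointVertex (𝒰 : CechCover Y) (y : Y) : y ∈ 𝒰.cell (𝒰.pointVertex y) :=
  (𝒰.exists_mem_cell y).choose_spec

theorem isLocallyConstant_vertexClass (𝒰 : CechCover Y) :
    IsLocallyConstant fun y => 𝒰.vertexClass k (𝒰.pointVertex y) := by
  refine (IsLocallyConstant.iff_eventually_eq _).2 fun y => ?_
  filter_upwards [(𝒰.isOpen (𝒰.pointVertex y).1).mem_nhds (𝒰.mem_cell_pointVertex y)] with z hz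
  exact 𝒰.vertexClass_eq k (𝒰.mem_cell_pointVertex z) hz

theorem mem_span_vertexClass (𝒰 : CechCover Y) (c : 𝒰.NerveH0 k) :
    c ∈ Submodule.span k (range (𝒰.vertexClass k)) := by
  induction c using Submodule.Quotient.induction_on with
  | H c =>
    induction c using Finsupp.induction_linear with
    | zero => exact Submodule.zero_mem _
    | add a b ha hb => exact Submodule.add_mem _ ha hb
    | single i a =>
      have h : (Submodule.Quotient.mk (Finsupp.single i a) : 𝒰.NerveH0 k)
          = a • 𝒰.vertexClass k i := by
        rw [vertexClass, ← Submodule.Quotient.mk_smul, Finsupp.smul_single, smul_eq_mul, mul_one]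
      rw [h]
      exact Submodule.smul_mem _ _ (Submodule.subset_span ⟨i, rfl⟩)

/-- The common refinement of two covers. -/
def inter (𝒰 𝒱 : CechCover Y) : CechCover Y where
  ι := 𝒰.ι × 𝒱.ι
  U i := 𝒰.U i.1 ∩ 𝒱.U i.2
  isOpen i := (𝒰.isOpen i.1).inter (𝒱.isOpen i.2)
  iUnion_eq := by
    refine eq_univ_of_forall fun y => ?_
    exact mem_iUnion.2 ⟨((𝒰.pointVertex y).1, (𝒱.pointVertex y).1),
      𝒰.mem_cell_pointVertex y, 𝒱.mem_cell_pointVertex y⟩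

/-- The cover by the common refinement of the partitions `{K a b, (K a b)ᶜ}`. -/
def ofClopens {ι : Type u} [Finite ι] (K : ι → ι → Set Y) (hK : ∀ a b, IsClopen (K a b)) :
    CechCover Y where
  ι := ι → ι → Prop
  U τ := ⋂ a, ⋂ b, {y | y ∈ K a b ↔ τ a b}
  isOpen τ := by
    refine isOpen_iInter_of_finite fun a => isOpen_iInter_of_finite fun b => ?_
    by_cases h : τ a b
    · simpa [h] using (hK a b).isOpen
    · simp only [h, iff_false]
      exact (hK a b).compl.isOpen
  iUnion_eq := by
    refine eq_univ_of_forall fun y => mem_iUnion.2 ⟨fun a b => y ∈ K a b, ?_⟩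
    simp

variable {ι : Type u} [Finite ι] {K : ι → ι → Set Y} (hK : ∀ a b, IsClopen (K a b))

theorem ofClopens_cell_iff {i : (ofClopens K hK).Vertex} {y : Y} :
    y ∈ (ofClopens K hK).cell i ↔ ∀ a b, y ∈ K a b ↔ i.1 a b := by
  change y ∈ (⋂ a, ⋂ b, {y | y ∈ K a b ↔ i.1 a b}) ↔ _
  simp

/-- Distinct cells of a partition are disjoint, so every edge of the nerve is a loop and coordinates
of chains descend to homology. -/
theorem ofClopens_boundaries : (ofClopens K hK).boundaries k = ⊥ := by
  refine Submodule.span_eq_bot.2 ?_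
  rintro _ ⟨i, j, ⟨y, hi, hj⟩, rfl⟩
  have h : i = j := by
    refine Subtype.ext (funext fun a => funext fun b => propext ?_)
    exact ((ofClopens_cell_iff hK).1 hi a b).symm.trans ((ofClopens_cell_iff hK).1 hj a b)
  rw [h, sub_self]

end CechCover

/-- The class of a point in degree zero Čech homology. -/
noncomputable def CechH0.point (y : Y) : CechH0 k Y :=
  ⟨fun 𝒰 => 𝒰.vertexClass k (𝒰.pointVertex y), fun 𝒰 𝒱 φ h => by
    rw [CechCover.push_vertexClass]
    exact 𝒰.vertexClass_eq k (h _ (𝒱.mem_cell_pointVertex y)) (𝒰.mem_cell_pointVertex y)⟩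

theorem CechH0.point_eq {y z : Y} (h : z ∈ connectedComponent y) :
    CechH0.point k y = CechH0.point k z := by
  refine Subtype.ext (funext fun 𝒰 => ?_)
  exact (𝒰.isLocallyConstant_vertexClass k).apply_eq_of_isPreconnected
    isPreconnected_connectedComponent mem_connectedComponent h

theorem CechH0.map_point (g : C(Y, Z)) (y : Y) :
    CechH0.map k g (CechH0.point k y) = CechH0.point k (g y) := by
  refine Subtype.ext (funext fun 𝒰 => ?_)
  change CechCover.push k _ g _ (CechCover.vertexClass k _ _) = CechCover.vertexClass k _ _
  rw [CechCover.push_vertexClass]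
  exact 𝒰.vertexClass_eq k ((𝒰.pullback g).mem_cell_pointVertex y) (𝒰.mem_cell_pointVertex (g y))

/-- Every vertex of the pulled-back nerve has a point in its cell. The coefficients obtained this
way may depend on the cover; `CechH0.exists_dual` makes them uniform. -/
theorem CechH0.map_apply_mem_span (g : C(Y, Z)) (c : CechH0 k Y) (𝒰 : CechCover Z) :
    (CechH0.map k g c).1 𝒰 ∈
      Submodule.span k (range fun y : Y => (CechH0.point k (g y)).1 𝒰) := by
  have h := Submodule.mem_map_of_mem
    (f := CechCover.push k (𝒰.pullbackVertex g) g (𝒰.mapsTo_pullbackVertex g))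
    ((𝒰.pullback g).mem_span_vertexClass k (c.1 (𝒰.pullback g)))
  rw [Submodule.map_span] at h
  refine Submodule.span_mono ?_ h
  rintro _ ⟨_, ⟨i, rfl⟩, rfl⟩
  obtain ⟨y, hy⟩ := i.2
  refine ⟨y, ?_⟩
  rw [CechCover.push_vertexClass]
  exact 𝒰.vertexClass_eq k (𝒰.mem_cell_pointVertex (g y)) hy

/-- Finitely many points that are pairwise separated by clopen sets are dual to linear functionals
on Čech homology, which determine the classes supported by these points. -/
theorem CechH0.exists_dual {ι : Type u} [Fintype ι] [DecidableEq ι] (z : ι → Z)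
    (hz : ∀ a b, a ≠ b → ∃ K : Set Z, IsClopen K ∧ z a ∈ K ∧ z b ∉ K) :
    ∃ E : CechH0 k Z →ₗ[k] (ι → k), (∀ a, E (CechH0.point k (z a)) = Pi.single a 1) ∧
      ∀ c : CechH0 k Z,
        (∀ 𝒰, c.1 𝒰 ∈ Submodule.span k (range fun a => (CechH0.point k (z a)).1 𝒰)) →
        c = ∑ a, E c a • CechH0.point k (z a) := by
  have hK' : ∀ a b, ∃ K : Set Z, IsClopen K ∧ (a ≠ b → z a ∈ K ∧ z b ∉ K) := by
    intro a b
    by_cases h : a = b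
    · exact ⟨∅, isClopen_empty, fun h' => absurd h h'⟩
    · obtain ⟨K, h1, h2⟩ := hz a b h
      exact ⟨K, h1, fun _ => h2⟩
  choose K hK hsep using hK'
  let 𝒰₀ := CechCover.ofClopens K hK
  let v : ι → 𝒰₀.Vertex := fun a => 𝒰₀.pointVertex (z a)
  have hv : ∀ a b, v b = v a ↔ a = b := by
    intro a b
    refine ⟨fun h => ?_, fun h => by rw [h]⟩
    by_contra hne
    have h1 := (CechCover.ofClopens_cell_iff hK).1 (𝒰₀.mem_cell_pointVertex (z a)) a b
    have h2 := (CechCover.ofClopens_cell_iff hK).1 (𝒰₀.mem_cell_pointVertex (z b)) a b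
    change 𝒰₀.pointVertex (z b) = 𝒰₀.pointVertex (z a) at h
    rw [h] at h2
    exact (hsep a b hne).2 (h2.2 (h1.1 (hsep a b hne).1))
  let coord : ι → 𝒰₀.NerveH0 k →ₗ[k] k := fun a =>
    Submodule.liftQ _ (Finsupp.lapply (v a)) (by
      rw [CechCover.ofClopens_boundaries]; exact bot_le)
  let E : CechH0 k Z →ₗ[k] (ι → k) :=
    LinearMap.pi fun a => coord a ∘ₗ LinearMap.proj 𝒰₀ ∘ₗ (CechH0 k Z).subtype
  have hcoord : ∀ a b, coord a ((CechH0.point k (z b)).1 𝒰₀) = (Pi.single b 1 : ι → k) a := by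
    intro a b
    change (Finsupp.single (v b) (1 : k)) (v a) = _
    rw [Pi.single_apply]
    by_cases h : a = b
    · rw [if_pos h, (hv a b).2 h, Finsupp.single_eq_same]
    · rw [if_neg h, Finsupp.single_eq_of_ne fun h' => h ((hv a b).1 h'.symm)]
  have hE : ∀ c a, E c a = coord a (c.1 𝒰₀) := fun c a => rfl
  refine ⟨E, fun a => funext fun b => hcoord b a, fun c hc => ?_⟩
  refine Subtype.ext (funext fun 𝒰 => ?_)
  -- Coefficients over the common refinement serve for both covers, and over `𝒰₀` they are forced to
  -- be `E c`. Hence they do not depend on `𝒰`.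
  let 𝒲 := 𝒰.inter 𝒰₀
  let φ : 𝒲.Vertex → 𝒰.Vertex := fun i => ⟨i.1.1, i.2.mono inter_subset_left⟩
  let ψ : 𝒲.Vertex → 𝒰₀.Vertex := fun i => ⟨i.1.2, i.2.mono inter_subset_right⟩
  have hφ : ∀ i, MapsTo (ContinuousMap.id Z) (𝒲.cell i) (𝒰.cell (φ i)) := fun i y hy => hy.1
  have hψ : ∀ i, MapsTo (ContinuousMap.id Z) (𝒲.cell i) (𝒰₀.cell (ψ i)) := fun i y hy => hy.2
  obtain ⟨b, hb⟩ := (Submodule.mem_span_range_iff_exists_fun k).1 (hc 𝒲)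
  have h1 : c.1 𝒰₀ = ∑ a, b a • (CechH0.point k (z a)).1 𝒰₀ := by
    rw [← c.2 𝒰₀ 𝒲 ψ hψ, ← hb, map_sum]
    exact Finset.sum_congr rfl fun a _ => by
      rw [map_smul, (CechH0.point k (z a)).2 𝒰₀ 𝒲 ψ hψ]
  have h2 : c.1 𝒰 = ∑ a, b a • (CechH0.point k (z a)).1 𝒰 := by
    rw [← c.2 𝒰 𝒲 φ hφ, ← hb, map_sum]
    exact Finset.sum_congr rfl fun a _ => by
      rw [map_smul, (CechH0.point k (z a)).2 𝒰 𝒲 φ hφ]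
  have h3 : ∀ a, E c a = b a := by
    intro a
    rw [hE, h1, map_sum]
    simp only [map_smul, hcoord, Pi.single_apply, smul_eq_mul, mul_ite, mul_one, mul_zero,
      Finset.sum_ite_eq, Finset.mem_univ, if_true]
  rw [h2]
  simp only [h3, Submodule.coe_sum, Submodule.coe_smul, Finset.sum_apply, Pi.smul_apply]

/-- The classes of the points `g (y a)` span the range because connected points have equal classes,
and they are independent by the dual functionals. -/
theorem CechH0.finrank_range_map (g : C(Y, Z)) {ι : Type u} [Fintype ι] (y : ι → Y)
    (hy : ∀ a b, a ≠ b → ∃ K : Set Z, IsClopen K ∧ g (y a) ∈ K ∧ g (y b) ∉ K)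
    (hcov : ∀ x : Y, ∃ a, g (y a) ∈ connectedComponent (g x)) :
    Module.finrank k (LinearMap.range (CechH0.map k g)) = Fintype.card ι := by
  classical
  obtain ⟨E, hE, hsum⟩ := CechH0.exists_dual k (fun a => g (y a)) hy
  have hspan : LinearMap.range (CechH0.map k g)
      = Submodule.span k (range fun a => CechH0.point k (g (y a))) := by
    refine le_antisymm ?_ (Submodule.span_le.2 ?_)
    · rintro _ ⟨c, rfl⟩
      rw [hsum (CechH0.map k g c) fun 𝒰 => ?_]
      · exact Submodule.sum_mem _ fun a _ =>
          Submodule.smul_mem _ _ (Submodule.subset_span ⟨a, rfl⟩)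
      · refine Submodule.span_mono ?_ (CechH0.map_apply_mem_span k g c 𝒰)
        rintro _ ⟨x, rfl⟩
        obtain ⟨a, ha⟩ := hcov x
        exact ⟨a, by simp only [CechH0.point_eq k ha]⟩
    · rintro _ ⟨a, rfl⟩
      exact ⟨CechH0.point k (y a), CechH0.map_point k g (y a)⟩
  have hli : LinearIndependent k fun a => CechH0.point k (g (y a)) := by
    refine LinearIndependent.of_comp E ?_
    have : (E ∘ fun a => CechH0.point k (g (y a))) = fun a => Pi.single a (1 : k) :=
      funext hE
    rw [this]
    exact Pi.linearIndependent_single_one ι k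
  rw [hspan, finrank_span_eq_card hli]

end Cech

theorem IsTransversal.superlevelRank_eq (k : Type v) [Field k] {X : Type u} [MetricSpace X]
    [CompactSpace X] [LLCSpace X] {f : C(X, ℝ)} {r s : ℝ} (hsr : s ≤ r) {T : Finset X}
    (hT : IsTransversal f r s T) : superlevelRank k f r s = T.card := by
  rw [superlevelRank, dif_pos hsr,
    CechH0.finrank_range_map k _ (ι := T) (fun t => (⟨t.1, hT.le t.1 t.2⟩ : superlevel f r)) ?_ ?_,
    Fintype.card_coe]
  · intro a b hab
    exact exists_isClopen_of_passLevel_lt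
      (hT.lt a.1 a.2 b.1 b.2 fun h => hab (Subtype.ext h))
  · intro x
    obtain ⟨t, ht, hle⟩ := hT.exists_le x.1 x.2
    exact ⟨⟨t, ht⟩, mem_connectedComponent_of_le_passLevel hle⟩

/-! ### The elder rule -/

open Classical in
-- Inclusion–exclusion, checked element by element; the right side has the shape used in `barMult`.
theorem card_filter_rectangle {α : Type u} (T : Finset α) (f : α → ℝ) (D : α → WithBot ℝ) {r₁ r₂ s₁ s₂ : ℝ}
    (hr : r₁ ≤ r₂) (hs : s₁ ≤ s₂) :
    ({i ∈ T | (r₁ ≤ f i ∧ f i < r₂) ∧ (s₁ : WithBot ℝ) ≤ D i ∧ D i < s₂}.card : ℤ)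
      = {i ∈ T | r₁ ≤ f i ∧ D i < s₂}.card - {i ∈ T | r₂ ≤ f i ∧ D i < s₂}.card
        - {i ∈ T | r₁ ≤ f i ∧ D i < s₁}.card + {i ∈ T | r₂ ≤ f i ∧ D i < s₁}.card := by
  simp only [Finset.card_filter, Nat.cast_sum]
  rw [← Finset.sum_sub_distrib, ← Finset.sum_sub_distrib, ← Finset.sum_add_distrib]
  refine Finset.sum_congr rfl fun i _ => ?_
  have h1 : r₂ ≤ f i → r₁ ≤ f i := hr.trans
  have h2 : D i < s₁ → D i < s₂ := fun h => h.trans_le (WithBot.coe_le_coe.2 hs)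
  have h3 : (f i < r₂) = ¬ r₂ ≤ f i := by simp
  have h4 : ((s₁ : WithBot ℝ) ≤ D i) = ¬ D i < s₁ := by simp
  simp only [h3, h4]
  by_cases a : r₁ ≤ f i <;> by_cases b : r₂ ≤ f i <;> by_cases c : D i < s₁ <;>
    by_cases d : D i < s₂ <;>
    first
    | exact absurd (h1 b) a
    | exact absurd (h2 c) d
    | simp only [a, b, c, d, and_true, and_false, and_self, not_true_eq_false,
        not_false_eq_true, if_true, if_false]; norm_num

section Bars

variable {X : Type u} [MetricSpace X] [CompactSpace X] [LLCSpace X]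

open Classical in
/-- The elder rule: below a fixed pair of levels `s < r`, the superlevel ranks count finitely many
bars, born at `f i` and dying at `D i`. -/
theorem exists_bars (k : Type v) [Field k] (f : C(X, ℝ)) {r s : ℝ} (hsr : s < r) :
    ∃ (T : Finset X) (D : X → WithBot ℝ), (∀ i ∈ T, D i < s) ∧ {i ∈ T | D i = ⊥}.card ≤ 1 ∧
      ∀ r' s', r ≤ r' → s' ≤ s →
        superlevelRank k f r' s' = {i ∈ T | r' ≤ f i ∧ D i < s'}.card := by
  obtain ⟨T, hT, hmax⟩ := exists_isTransversal f hsr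
  -- An enumeration breaks ties between equal births, so that `key` orders `T` by age; a larger key
  -- means older.
  obtain ⟨e, he⟩ := Set.countable_iff_exists_injOn.1 T.countable_toSet
  let key : X → ℝ ×ₗ ℕ := fun x => toLex (f x, e x)
  have hkey : ∀ i ∈ T, ∀ j ∈ T, key i = key j → i = j := by
    intro i hi j hj h
    have h1 : (f i, e i) = (f j, e j) := toLex.injective h
    exact he hi hj (Prod.ext_iff.1 h1).2
  have hkeyf : ∀ i j, key i ≤ key j → f i ≤ f j := by
    intro i j h
    rcases Prod.Lex.le_iff.1 h with h | h
    · exact h.le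
    · exact h.1.le
  -- The class of `i` dies at the highest level where it meets an older one. The empty supremum `⊥`
  -- marks the oldest, which never dies.
  let D : X → WithBot ℝ := fun i =>
    ({j ∈ T | key i < key j} : Finset X).sup fun j => (passLevel f i j : WithBot ℝ)
  have hD : ∀ (i : X) (s' : ℝ), D i < s' ↔ ∀ j ∈ T, key i < key j → passLevel f i j < s' := by
    intro i s'
    rw [Finset.sup_lt_iff (WithBot.bot_lt_coe s')]
    simp only [Finset.mem_filter, and_imp, WithBot.coe_lt_coe]
  refine ⟨T, D, fun i hi => (hD i s).2 fun j hj hij => hT.lt i hi j hj ?_, ?_, ?_⟩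
  · rintro rfl
    exact lt_irrefl _ hij
  · have hbot : ∀ i j, j ∈ T → D i = ⊥ → ¬ key i < key j := by
      intro i j hj hi hij
      have h1 : (passLevel f i j : WithBot ℝ) ≤ D i :=
        Finset.le_sup (f := fun j => (passLevel f i j : WithBot ℝ))
          (Finset.mem_filter.2 ⟨hj, hij⟩)
      rw [hi, le_bot_iff] at h1
      exact WithBot.coe_ne_bot h1
    refine Finset.card_le_one.2 fun i hi j hj => ?_
    rw [Finset.mem_filter] at hi hj
    exact hkey i hi.1 j hj.1 (le_antisymm (not_lt.1 (hbot j i hi.1 hj.2))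
      (not_lt.1 (hbot i j hj.1 hi.2)))
  · intro r' s' hr hs
    refine IsTransversal.superlevelRank_eq k (hs.trans (hsr.le.trans hr)) ⟨?_, ?_, ?_⟩
    · intro t ht
      exact (Finset.mem_filter.1 ht).2.1
    · intro i hi j hj hne
      obtain ⟨hi, -, hi'⟩ := Finset.mem_filter.1 hi
      obtain ⟨hj, -, hj'⟩ := Finset.mem_filter.1 hj
      rcases lt_or_gt_of_ne (fun h => hne (hkey i hi j hj h)) with h | h
      · exact (hD i s').1 hi' j hj h
      · rw [passLevel_comm]
        exact (hD j s').1 hj' i hi h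
    · intro x hx
      obtain ⟨t, ht, hxt⟩ := hT.exists_le x (hr.trans hx)
      have htt : s' ≤ passLevel f t t := by
        rw [passLevel_self]
        exact (hs.trans hxt).trans (passLevel_le_right f x t)
      -- The oldest element joined to `t` at level `s'` meets nothing older there, so it is still
      -- alive at `s'`.
      obtain ⟨m, hm, hmmax⟩ := ({j ∈ T | s' ≤ passLevel f t j} : Finset X).exists_max_image key
        ⟨t, Finset.mem_filter.2 ⟨ht, htt⟩⟩
      obtain ⟨hmT, htm⟩ := Finset.mem_filter.1 hm
      refine ⟨m, Finset.mem_filter.2 ⟨hmT, ?_, (hD m s').2 fun j hj hlt => ?_⟩,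
        le_passLevel_trans (hs.trans hxt) htm⟩
      · exact (hx.trans (hmax t ht x hxt)).trans
          (hkeyf t m (hmmax t (Finset.mem_filter.2 ⟨ht, htt⟩)))
      · by_contra! hle
        exact absurd (hmmax j (Finset.mem_filter.2 ⟨hj, le_passLevel_trans htm hle⟩))
          (not_le.2 hlt)

open Classical in
-- The alternating sum of ranks counts the pairs `(f i, D i)` in a half-open rectangle. As `T` is
-- finite, a small rectangle around `(β, δ)` counts only that point, and no admissible rectangle
-- counts less.
theorem barMult_eq (k : Type v) [Field k] (f : C(X, ℝ)) {r s : ℝ} (hsr : s < r)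
    {T : Finset X} {D : X → WithBot ℝ}
    (hTD : ∀ r' s', r ≤ r' → s' ≤ s →
        superlevelRank k f r' s' = {i ∈ T | r' ≤ f i ∧ D i < s'}.card) {β δ : ℝ}
    (hβ : r < β) (hδ : δ < s) :
    barMult (superlevelRank k f) β δ = {i ∈ T | f i = β ∧ D i = δ}.card := by
  have hrect : ∀ {r₁ r₂ s₁ s₂ : ℝ}, r ≤ r₁ → r₁ ≤ r₂ → s₁ ≤ s₂ → s₂ ≤ s →
      ({i ∈ T | (r₁ ≤ f i ∧ f i < r₂) ∧ (s₁ : WithBot ℝ) ≤ D i ∧ D i < s₂}.card : ℤ)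
        = superlevelRank k f r₁ s₂ - superlevelRank k f r₂ s₂ - superlevelRank k f r₁ s₁
          + superlevelRank k f r₂ s₁ := by
    intro r₁ r₂ s₁ s₂ h1 h2 h3 h4
    rw [hTD r₁ s₂ h1 h4, hTD r₂ s₂ (h1.trans h2) h4, hTD r₁ s₁ h1 (h3.trans h4),
      hTD r₂ s₁ (h1.trans h2) (h3.trans h4), card_filter_rectangle T f D h2 h3]
  have hmem : {i ∈ T | f i = β ∧ D i = δ}.card ∈ {n : ℕ | ∃ s₁ s₂ r₁ r₂ : ℝ, s₁ < δ ∧ δ < s₂ ∧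
      s₂ < r₁ ∧ r₁ < β ∧ β < r₂ ∧ (n : ℤ) = superlevelRank k f r₁ s₂ - superlevelRank k f r₂ s₂
        - superlevelRank k f r₁ s₁ + superlevelRank k f r₂ s₁} := by
    have e1 : ∀ᶠ r₁ in 𝓝[<] β, r < r₁ ∧ ∀ i ∈ T, r₁ ≤ f i → β ≤ f i := by
      refine (eventually_nhdsWithin_of_eventually_nhds (lt_mem_nhds hβ)).and ?_
      refine (Finset.eventually_all T).2 fun i _ => ?_
      rcases lt_or_ge (f i) β with h | h
      · filter_upwards [eventually_nhdsWithin_of_eventually_nhds (lt_mem_nhds h)] with r₁ h1 h2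
        exact absurd h1 (not_lt.2 h2)
      · exact Eventually.of_forall fun _ _ => h
    have e2 : ∀ᶠ r₂ in 𝓝[>] β, ∀ i ∈ T, f i < r₂ → f i ≤ β := by
      refine (Finset.eventually_all T).2 fun i _ => ?_
      rcases lt_or_ge β (f i) with h | h
      · filter_upwards [eventually_nhdsWithin_of_eventually_nhds (gt_mem_nhds h)] with r₁ h1 h2
        exact absurd h1 (not_lt.2 h2.le)
      · exact Eventually.of_forall fun _ _ => h
    have e3 : ∀ᶠ s₁ : ℝ in 𝓝[<] δ, ∀ i ∈ T, (s₁ : WithBot ℝ) ≤ D i → δ ≤ D i := by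
      refine (Finset.eventually_all T).2 fun i _ => ?_
      induction D i using WithBot.recBotCoe with
      | bot => simp
      | coe d =>
        simp only [WithBot.coe_le_coe]
        rcases lt_or_ge d δ with h | h
        · filter_upwards [eventually_nhdsWithin_of_eventually_nhds (lt_mem_nhds h)] with r₁ h1 h2
          exact absurd h1 (not_lt.2 h2)
        · exact Eventually.of_forall fun _ _ => h
    have e4 : ∀ᶠ s₂ : ℝ in 𝓝[>] δ, s₂ < s ∧ ∀ i ∈ T, D i < s₂ → D i ≤ δ := by
      refine (eventually_nhdsWithin_of_eventually_nhds (gt_mem_nhds hδ)).and ?_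
      refine (Finset.eventually_all T).2 fun i _ => ?_
      induction D i using WithBot.recBotCoe with
      | bot => simp
      | coe d =>
        simp only [WithBot.coe_le_coe, WithBot.coe_lt_coe]
        rcases lt_or_ge δ d with h | h
        · filter_upwards [eventually_nhdsWithin_of_eventually_nhds (gt_mem_nhds h)] with r₁ h1 h2
          exact absurd h1 (not_lt.2 h2.le)
        · exact Eventually.of_forall fun _ _ => h
    obtain ⟨r₁, ⟨hr1, hr1'⟩, hr1β⟩ := (e1.and self_mem_nhdsWithin).exists
    obtain ⟨r₂, hr2', hr2β⟩ := (e2.and self_mem_nhdsWithin).exists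
    obtain ⟨s₁, hs1', hs1δ⟩ := (e3.and self_mem_nhdsWithin).exists
    obtain ⟨s₂, ⟨hs2, hs2'⟩, hs2δ⟩ := (e4.and self_mem_nhdsWithin).exists
    change r₁ < β at hr1β
    change β < r₂ at hr2β
    change s₁ < δ at hs1δ
    change δ < s₂ at hs2δ
    refine ⟨s₁, s₂, r₁, r₂, hs1δ, hs2δ, by linarith, hr1β, hr2β, ?_⟩
    rw [← hrect hr1.le (hr1β.trans hr2β).le (hs1δ.trans hs2δ).le hs2.le]
    congr 2
    refine Finset.filter_congr fun i hi => ?_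
    constructor
    · rintro ⟨h1, h2⟩
      rw [h1, h2]
      exact ⟨⟨hr1β.le, hr2β⟩, WithBot.coe_le_coe.2 hs1δ.le, WithBot.coe_lt_coe.2 hs2δ⟩
    · rintro ⟨⟨h1, h2⟩, h3, h4⟩
      exact ⟨le_antisymm (hr2' i hi h2) (hr1' i hi h1),
        le_antisymm (hs2' i hi h4) (hs1' i hi h3)⟩
  refine le_antisymm (Nat.sInf_le hmem) (le_csInf ⟨_, hmem⟩ ?_)
  -- An arbitrary rectangle may leave the range where `T` and `D` give the ranks. It gets its own
  -- family `T'`, `D'`; on the part of the rectangle inside that range both families have the same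
  -- count.
  rintro n ⟨s₁, s₂, r₁, r₂, hs1, hs2, hsr', hr1, hr2, hn⟩
  obtain ⟨T', D', -, -, hTD'⟩ := exists_bars k f hsr'
  have hn' : (n : ℤ) = {i ∈ T' | (r₁ ≤ f i ∧ f i < r₂) ∧ (s₁ : WithBot ℝ) ≤ D' i ∧
      D' i < s₂}.card := by
    rw [card_filter_rectangle T' f D' (hr1.trans hr2).le (hs1.trans hs2).le, hn,
      hTD' r₁ s₂ le_rfl le_rfl, hTD' r₂ s₂ (hr1.trans hr2).le le_rfl,
      hTD' r₁ s₁ le_rfl (hs1.trans hs2).le, hTD' r₂ s₁ (hr1.trans hr2).le (hs1.trans hs2).le]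
  have a1 : max r₁ r ≤ r₂ := max_le (hr1.trans hr2).le (hβ.trans hr2).le
  have a2 : s₁ ≤ min s₂ s := le_min (hs1.trans hs2).le (hs1.trans hδ).le
  have hsmall : ({i ∈ T' | (max r₁ r ≤ f i ∧ f i < r₂) ∧ (s₁ : WithBot ℝ) ≤ D' i ∧
      D' i < (min s₂ s : ℝ)}.card : ℤ) = {i ∈ T | (max r₁ r ≤ f i ∧ f i < r₂) ∧
      (s₁ : WithBot ℝ) ≤ D i ∧ D i < (min s₂ s : ℝ)}.card := by
    rw [card_filter_rectangle T' f D' a1 a2, hrect (le_max_right _ _) a1 a2 (min_le_right _ _),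
      hTD' _ _ (le_max_left _ _) (min_le_left _ _),
      hTD' _ _ (hr1.trans hr2).le (min_le_left _ _),
      hTD' _ _ (le_max_left _ _) (hs1.trans hs2).le,
      hTD' _ _ (hr1.trans hr2).le (hs1.trans hs2).le]
  have hle1 : {i ∈ T' | (max r₁ r ≤ f i ∧ f i < r₂) ∧ (s₁ : WithBot ℝ) ≤ D' i ∧
      D' i < (min s₂ s : ℝ)}.card ≤ {i ∈ T' | (r₁ ≤ f i ∧ f i < r₂) ∧
      (s₁ : WithBot ℝ) ≤ D' i ∧ D' i < s₂}.card := by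
    refine Finset.card_le_card (Finset.monotone_filter_right _ fun i _ h => ?_)
    exact ⟨⟨(le_max_left _ _).trans h.1.1, h.1.2⟩, h.2.1,
      h.2.2.trans_le (WithBot.coe_le_coe.2 (min_le_left _ _))⟩
  have hle2 : {i ∈ T | f i = β ∧ D i = δ}.card ≤ {i ∈ T | (max r₁ r ≤ f i ∧ f i < r₂) ∧
      (s₁ : WithBot ℝ) ≤ D i ∧ D i < (min s₂ s : ℝ)}.card := by
    refine Finset.card_le_card (Finset.monotone_filter_right _ fun i _ h => ?_)
    rw [h.1, h.2]
    exact ⟨⟨max_le hr1.le hβ.le, hr2⟩, WithBot.coe_le_coe.2 hs1.le,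
      WithBot.coe_lt_coe.2 (lt_min hs2 hδ)⟩
  omega

open Classical in
/-- The bars that contain `[s, r]` in their interior are at most the rank. -/
theorem sum_barMult_le (k : Type v) [Field k] (f : C(X, ℝ)) {r s : ℝ} (hsr : s < r)
    (F : Finset (ℝ × ℝ)) (hF : ∀ b ∈ F, r < b.1 ∧ b.2 < s) :
    ∑ b ∈ F, barMult (superlevelRank k f) b.1 b.2 ≤ superlevelRank k f r s := by
  obtain ⟨T, D, hDs, -, hTD⟩ := exists_bars k f hsr
  rw [hTD r s le_rfl le_rfl, Finset.sum_congr rfl fun b hb =>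
    barMult_eq k f hsr hTD (hF b hb).1 (hF b hb).2, ← Finset.card_biUnion]
  · refine Finset.card_le_card (Finset.biUnion_subset.2 fun b hb => ?_)
    refine Finset.monotone_filter_right _ fun i _ h => ?_
    rw [h.1, h.2]
    exact ⟨(hF b hb).1.le, WithBot.coe_lt_coe.2 (hF b hb).2⟩
  · intro b _ b' _ hne
    rw [Function.onFun, Finset.disjoint_filter]
    rintro i - ⟨h1, h2⟩ ⟨h3, h4⟩
    exact hne (Prod.ext (h1.symm.trans h3) (WithBot.coe_injective (h2.symm.trans h4)))

open Classical in
/-- The rank is at most one more than the number of finite bars that contain `[s, r]`. -/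
theorem superlevelRank_le_sum (k : Type v) [Field k] (f : C(X, ℝ)) {r s : ℝ} (hsr : s < r) :
    ∃ F : Finset (ℝ × ℝ), (∀ b ∈ F, r ≤ b.1 ∧ b.2 < s) ∧
      superlevelRank k f r s ≤ 1 + ∑ b ∈ F, barMult (superlevelRank k f) b.1 b.2 := by
  -- Working above `r₀ < r` lets `barMult_eq` apply to bars born exactly at `r`.
  obtain ⟨r₀, h1, h2⟩ := exists_between hsr
  obtain ⟨T, D, hDs, hbot, hTD⟩ := exists_bars k f h1
  let T₁ : Finset X := {i ∈ T | r ≤ f i ∧ D i ≠ ⊥}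
  refine ⟨T₁.image fun i => (f i, (D i).unbotD 0), ?_, ?_⟩
  · intro b hb
    obtain ⟨i, hi, rfl⟩ := Finset.mem_image.1 hb
    obtain ⟨hi, h3, h4⟩ := Finset.mem_filter.1 hi
    exact ⟨h3, by
      obtain ⟨d, hd⟩ := WithBot.ne_bot_iff_exists.1 h4
      have := hDs i hi
      rw [← hd] at this ⊢
      exact WithBot.coe_lt_coe.1 this⟩
  · have hT₁ : T₁.card ≤ ∑ b ∈ T₁.image fun i => (f i, (D i).unbotD 0),
        barMult (superlevelRank k f) b.1 b.2 := by
      rw [Finset.card_eq_sum_card_image fun i => (f i, (D i).unbotD 0)]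
      refine Finset.sum_le_sum fun b hb => ?_
      obtain ⟨i, hi, rfl⟩ := Finset.mem_image.1 hb
      obtain ⟨hi, h3, h4⟩ := Finset.mem_filter.1 hi
      obtain ⟨d, hd⟩ := WithBot.ne_bot_iff_exists.1 h4
      have hds : d < s := by
        have := hDs i hi
        rw [← hd] at this
        exact WithBot.coe_lt_coe.1 this
      rw [← hd, WithBot.unbotD_coe, barMult_eq k f h1 hTD (h2.trans_le h3) hds]
      refine Finset.card_le_card fun j hj => ?_
      obtain ⟨hj, h5⟩ := Finset.mem_filter.1 hj
      obtain ⟨hj, h6, h7⟩ := Finset.mem_filter.1 hj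
      obtain ⟨d', hd'⟩ := WithBot.ne_bot_iff_exists.1 h7
      rw [← hd', WithBot.unbotD_coe, Prod.mk.injEq] at h5
      exact Finset.mem_filter.2 ⟨hj, h5.1, by rw [← hd', h5.2]⟩
    -- The summand `1` pays for the only possible immortal bar.
    have hsub : ({i ∈ T | r ≤ f i ∧ D i < s} : Finset X) ⊆ {i ∈ T | D i = ⊥} ∪ T₁ := by
      intro i hi
      obtain ⟨hi, h3, -⟩ := Finset.mem_filter.1 hi
      by_cases h : D i = ⊥
      · exact Finset.mem_union_left _ (Finset.mem_filter.2 ⟨hi, h⟩)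
      · exact Finset.mem_union_right _ (Finset.mem_filter.2 ⟨hi, h3, h⟩)
    rw [hTD r s h2.le le_rfl]
    exact (Finset.card_le_card hsub).trans ((Finset.card_union_le _ _).trans
      (add_le_add hbot hT₁))

/-- Below the minimum of `f` the only component is the whole space. -/
theorem superlevelRank_of_le_iInf (k : Type v) [Field k] (f : C(X, ℝ)) {r s : ℝ} (hsr : s ≤ r)
    (hs : s ≤ ⨅ x, f x) : superlevelRank k f r s = if r ≤ ⨆ x, f x then 1 else 0 := by
  have hbdd : BddAbove (range f) := (isCompact_range f.continuous).bddAbove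
  split_ifs with h
  · obtain ⟨m, -, hm⟩ := isCompact_univ.exists_isMaxOn (s := (univ : Set X)) univ_nonempty
      f.continuous.continuousOn
    have hm' : ⨆ x, f x ≤ f m := ciSup_le fun x => hm (mem_univ x)
    refine (IsTransversal.superlevelRank_eq k (T := {m}) hsr ⟨?_, ?_, ?_⟩)
    · simpa using h.trans hm'
    · simp
    · exact fun x _ => ⟨m, by simp, hs.trans (iInf_le_passLevel f x m)⟩
  · refine (IsTransversal.superlevelRank_eq k (T := ∅) hsr ⟨by simp, by simp, fun x hx => ?_⟩)
    exact absurd (hx.trans (le_ciSup hbdd x)) h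

/-- At a level below `inf f` the rank, as a function of `r`, jumps only at `sup f`; a small window
around any other `β` sees no jump. -/
theorem essentialBarMult_eq_zero (k : Type v) [Field k] (f : C(X, ℝ)) {β : ℝ}
    (hβ : β ≠ ⨆ x, f x) : essentialBarMult (superlevelRank k f) β = 0 := by
  obtain ⟨ε, hε, hlt⟩ : ∃ ε > 0, (β - ε ≤ ⨆ x, f x ↔ β + ε ≤ ⨆ x, f x) := by
    rcases lt_or_gt_of_ne hβ with h | h
    · exact ⟨(⨆ x, f x) - β, by linarith, by constructor <;> intro <;> linarith⟩
    · refine ⟨(β - ⨆ x, f x) / 2, by linarith, ?_⟩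
      constructor <;> intro <;> linarith
  let s := min (⨅ x, f x) (β - ε - 1)
  have hs : s ≤ ⨅ x, f x := min_le_left _ _
  have hs' : s ≤ β - ε - 1 := min_le_right _ _
  have h1 := superlevelRank_of_le_iInf k f (r := β - ε) (s := s) (by linarith) hs
  have h2 := superlevelRank_of_le_iInf k f (r := β + ε) (s := s) (by linarith) hs
  refine Nat.le_zero.1 (Nat.sInf_le ⟨s, β - ε, β + ε, by linarith, by linarith, by linarith, ?_⟩)
  rw [h1, h2]
  simp only [hlt]
  simp

end Bars

/-! ### Estimates for the upper box dimension -/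

section BoxDim

theorem eventually_pos_lt_one : ∀ᶠ ε : ℝ≥0 in 𝓝[>] 0, 0 < (ε : ℝ) ∧ (ε : ℝ) < 1 := by
  have h : ∀ᶠ ε : ℝ≥0 in 𝓝[>] 0, ε < 1 :=
    eventually_nhdsWithin_of_eventually_nhds (gt_mem_nhds one_pos)
  filter_upwards [h, self_mem_nhdsWithin] with ε h1 h2
  exact ⟨NNReal.coe_pos.2 h2, by exact_mod_cast h1⟩

theorem tendsto_log_one_div_atTop :
    Tendsto (fun ε : ℝ≥0 => Real.log (1 / (ε : ℝ))) (𝓝[>] 0) atTop := by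
  have h : Tendsto (fun ε : ℝ≥0 => (ε : ℝ)) (𝓝[>] 0) (𝓝[>] 0) := by
    refine tendsto_nhdsWithin_iff.2 ⟨?_, ?_⟩
    · exact (NNReal.continuous_coe.tendsto' 0 0 rfl).mono_left nhdsWithin_le_nhds
    · filter_upwards [self_mem_nhdsWithin] with ε hε using NNReal.coe_pos.2 hε
  simp only [one_div]
  exact Real.tendsto_log_atTop.comp (tendsto_inv_nhdsGT_zero.comp h)

variable {Y : Type u} [PseudoMetricSpace Y]

theorem upperBoxDim_le_of_eventually {C p : ℝ} (hp : 0 ≤ p)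
    (h : ∀ᶠ ε : ℝ≥0 in 𝓝[>] 0, ((Metric.coveringNumber ε (univ : Set Y) : ℕ∞) : ℝ≥0∞)
      ≤ ENNReal.ofReal (C * (ε : ℝ) ^ (-p))) :
    upperBoxDim Y ≤ ENNReal.ofReal p := by
  refine ENNReal.le_of_forall_pos_le_add fun η hη _ => ?_
  have hη' : 0 < (η : ℝ) := NNReal.coe_pos.2 hη
  have hofReal : ENNReal.ofReal p + η = ENNReal.ofReal (p + η) := by
    rw [ENNReal.ofReal_add hp hη'.le, ENNReal.ofReal_coe_nnreal]
  rw [hofReal]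
  refine limsup_le_of_le (by isBoundedDefault) ?_
  -- For small `ε` the constant costs at most `η` in the exponent; `max C 1` keeps its logarithm
  -- defined.
  filter_upwards [h, eventually_pos_lt_one,
    tendsto_log_one_div_atTop.eventually_ge_atTop (Real.log (max C 1) / η)] with ε h1 h2 h3
  have hL : 0 < Real.log (1 / (ε : ℝ)) := by
    rw [one_div, Real.log_inv, neg_pos]
    exact Real.log_neg h2.1 h2.2
  rw [← EReal.real_coe_toENNReal]
  refine EReal.toENNReal_le_toENNReal ?_
  rw [EReal.div_le_iff_le_mul (by exact_mod_cast hL) (EReal.coe_ne_top _)]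
  have hC : 0 < max C 1 := lt_max_of_lt_right one_pos
  have hpos : 0 < (ε : ℝ) ^ (-p) := Real.rpow_pos_of_pos h2.1 _
  have h4 := ENNReal.log_monotone (h1.trans
    (ENNReal.ofReal_le_ofReal (mul_le_mul_of_nonneg_right (le_max_left C 1) hpos.le)))
  refine h4.trans ?_
  rw [ENNReal.log_ofReal_of_pos (mul_pos hC hpos), Real.log_mul hC.ne' hpos.ne',
    Real.log_rpow h2.1, ← EReal.coe_mul, EReal.coe_le_coe_iff]
  rw [div_le_iff₀ hη'] at h3
  rw [one_div, Real.log_inv] at h3 ⊢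
  linarith

theorem eventually_coveringNumber_le {q : ℝ} (h : upperBoxDim Y < ENNReal.ofReal q) :
    ∀ᶠ ε : ℝ≥0 in 𝓝[>] 0, ((Metric.coveringNumber ε (univ : Set Y) : ℕ∞) : ℝ≥0∞)
      ≤ ENNReal.ofReal ((ε : ℝ) ^ (-q)) := by
  filter_upwards [eventually_lt_of_limsup_lt h, eventually_pos_lt_one] with ε h1 h2
  have hL : 0 < Real.log (1 / (ε : ℝ)) := by
    rw [one_div, Real.log_inv, neg_pos]
    exact Real.log_neg h2.1 h2.2
  have h3 : ENNReal.log ((Metric.coveringNumber ε (univ : Set Y) : ℕ∞) : ℝ≥0∞) /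
      ((Real.log (1 / (ε : ℝ)) : ℝ) : EReal) ≤ (q : EReal) := by
    by_contra! hlt
    refine absurd h1 (not_lt.2 ?_)
    rw [← EReal.real_coe_toENNReal]
    exact EReal.toENNReal_le_toENNReal hlt.le
  rw [EReal.div_le_iff_le_mul (by exact_mod_cast hL) (EReal.coe_ne_top _)] at h3
  rw [← ENNReal.log_le_log_iff, ENNReal.log_ofReal_of_pos (Real.rpow_pos_of_pos h2.1 _),
    Real.log_rpow h2.1]
  refine h3.trans (le_of_eq ?_)
  rw [← EReal.coe_mul, EReal.coe_eq_coe_iff, one_div, Real.log_inv]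
  ring

/-- A 1-Lipschitz function sends `ε`-balls into intervals of length `2ε`; compare Lebesgue measures.
-/
theorem ofReal_sub_le_coveringNumber_mul {g : Y → ℝ} (hg : ∀ x y, |g x - g y| ≤ dist x y)
    {a b : ℝ} (hab : Icc a b ⊆ range g) (ε : ℝ≥0) (hε : 0 < ε) :
    ENNReal.ofReal (b - a) ≤
      ((Metric.coveringNumber ε (univ : Set Y) : ℕ∞) : ℝ≥0∞) * ENNReal.ofReal (2 * ε) := by
  by_cases htop : Metric.coveringNumber ε (univ : Set Y) = ⊤
  · rw [htop, ENat.toENNReal_top, ENNReal.top_mul]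
    · exact le_top
    · rw [ne_eq, ENNReal.ofReal_eq_zero, not_le]
      have : 0 < (ε : ℝ) := NNReal.coe_pos.2 hε
      positivity
  · obtain ⟨C, -, hfin, hcov, hcard⟩ := Metric.exists_set_encard_eq_coveringNumber htop
    have hsub : Icc a b ⊆ ⋃ c ∈ hfin.toFinset, Metric.closedBall (g c) ε := by
      intro t ht
      obtain ⟨y, rfl⟩ := hab ht
      obtain ⟨c, hc, hyc⟩ := hcov (mem_univ y)
      refine mem_iUnion₂.2 ⟨c, hfin.mem_toFinset.2 hc, ?_⟩
      rw [Metric.mem_closedBall, Real.dist_eq]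
      refine (hg y c).trans ?_
      have h1 : edist y c ≤ ε := hyc
      rw [edist_nndist] at h1
      exact_mod_cast h1
    calc ENNReal.ofReal (b - a) = MeasureTheory.volume (Icc a b) := Real.volume_Icc.symm
      _ ≤ MeasureTheory.volume (⋃ c ∈ hfin.toFinset, Metric.closedBall (g c) (ε : ℝ)) :=
        MeasureTheory.measure_mono hsub
      _ ≤ ∑ c ∈ hfin.toFinset, MeasureTheory.volume (Metric.closedBall (g c) (ε : ℝ)) :=
        MeasureTheory.measure_biUnion_finset_le _ _
      _ = _ := by
        simp only [Real.volume_closedBall, Finset.sum_const, nsmul_eq_mul]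
        rw [← hcard, hfin.encard_eq_coe_toFinset_card, ENat.toENNReal_coe]

theorem one_le_upperBoxDim {g : Y → ℝ} (hg : ∀ x y, |g x - g y| ≤ dist x y)
    {a b : ℝ} (hlt : a < b) (hab : Icc a b ⊆ range g) : 1 ≤ upperBoxDim Y := by
  by_contra! h
  obtain ⟨q, hq1, hq2⟩ := ENNReal.lt_iff_exists_nnreal_btwn.1 h
  have hq : (q : ℝ) < 1 := by exact_mod_cast hq2
  have hlim : Tendsto (fun ε : ℝ≥0 => 2 * (ε : ℝ) ^ (1 - (q : ℝ))) (𝓝[>] 0) (𝓝 0) := by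
    have hc : Continuous fun ε : ℝ≥0 => 2 * (ε : ℝ) ^ (1 - (q : ℝ)) :=
      continuous_const.mul (NNReal.continuous_coe.rpow_const fun _ => Or.inr (by linarith))
    refine (hc.tendsto' 0 0 ?_).mono_left nhdsWithin_le_nhds
    rw [NNReal.coe_zero, Real.zero_rpow (by linarith), mul_zero]
  rw [← ENNReal.ofReal_coe_nnreal] at hq1
  obtain ⟨ε, h1, h2, h3⟩ := ((eventually_coveringNumber_le hq1).and
    (eventually_pos_lt_one.and (hlim.eventually_lt_const (sub_pos.2 hlt)))).exists
  have h4 := (ofReal_sub_le_coveringNumber_mul hg hab ε (NNReal.coe_pos.1 h2.1)).trans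
    (mul_le_mul_left h1 _)
  rw [← ENNReal.ofReal_mul (Real.rpow_nonneg h2.1.le _)] at h4
  have h5 : (ε : ℝ) ^ (-(q : ℝ)) * (2 * ε) = 2 * (ε : ℝ) ^ (1 - (q : ℝ)) := by
    rw [sub_eq_add_neg, Real.rpow_add h2.1, Real.rpow_one]; ring
  rw [h5] at h4
  have h6 := (ENNReal.ofReal_le_ofReal_iff
    (mul_nonneg zero_le_two (Real.rpow_nonneg h2.1.le _))).1 h4
  linarith

theorem coveringNumber_univ_le_of_surjective {Z : Type u} [PseudoMetricSpace Z] {φ : Y → Z}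
    (hφ : Function.Surjective φ) {ε δ : ℝ≥0} (h : ∀ x y, dist x y ≤ ε → dist (φ x) (φ y) ≤ δ) :
    Metric.coveringNumber δ (univ : Set Z) ≤ Metric.coveringNumber ε (univ : Set Y) := by
  refine le_iInf fun C => le_iInf fun _ => le_iInf fun hC => ?_
  refine le_trans (Metric.IsCover.coveringNumber_le_encard (C := φ '' C) (subset_univ _) ?_)
    (encard_image_le φ C)
  intro z _
  obtain ⟨y, rfl⟩ := hφ z
  obtain ⟨c, hc, hyc⟩ := hC (mem_univ y)
  refine ⟨φ c, ⟨c, hc, rfl⟩, ?_⟩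
  have h1 : edist y c ≤ ε := hyc
  change edist (φ y) (φ c) ≤ δ
  rw [edist_nndist, ENNReal.coe_le_coe] at h1 ⊢
  exact h y c h1

theorem upperBoxDim_le_div_of_holder {Z : Type u} [PseudoMetricSpace Z] {φ : Y → Z}
    (hφ : Function.Surjective φ) {A α : ℝ} (hα : 0 < α)
    (h : ∀ x y, dist (φ x) (φ y) ≤ A * dist x y ^ α) :
    upperBoxDim Z ≤ 1 / ENNReal.ofReal α * upperBoxDim Y := by
  have hα' : ENNReal.ofReal α ≠ 0 := (ENNReal.ofReal_pos.2 hα).ne'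
  rw [mul_comm, mul_one_div, ENNReal.le_div_iff_mul_le (Or.inl hα') (Or.inl ENNReal.ofReal_ne_top)]
  refine le_of_forall_gt_imp_ge_of_dense fun q' hq' => ?_
  rcases eq_or_ne q' ⊤ with rfl | hq'top
  · exact le_top
  lift q' to ℝ≥0 using hq'top
  rw [← ENNReal.ofReal_coe_nnreal] at hq' ⊢
  set q : ℝ := (q' : ℝ)
  have hq0 : 0 ≤ q := q'.2
  rw [← ENNReal.le_div_iff_mul_le (Or.inl hα') (Or.inl ENNReal.ofReal_ne_top),
    ← ENNReal.ofReal_div_of_pos hα]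
  let B : ℝ≥0 := ⟨max A 1, zero_le_one.trans (le_max_right _ _)⟩
  have hB : 0 < B := lt_of_lt_of_le one_pos (show (1 : ℝ) ≤ max A 1 from le_max_right _ _)
  have hlim : Tendsto (fun δ : ℝ≥0 => (δ / B) ^ (1 / α)) (𝓝[>] 0) (𝓝[>] 0) := by
    refine tendsto_nhdsWithin_iff.2 ⟨?_, ?_⟩
    · have hc : Continuous fun δ : ℝ≥0 => (δ / B) ^ (1 / α) :=
        (NNReal.continuous_rpow_const (by positivity)).comp (continuous_id.div_const B)
      refine (hc.tendsto' 0 0 ?_).mono_left nhdsWithin_le_nhds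
      rw [zero_div, NNReal.zero_rpow (by positivity)]
    · filter_upwards [self_mem_nhdsWithin] with δ hδ
      exact NNReal.rpow_pos (div_pos hδ hB)
  -- A cover of `Y` at scale `(δ / B) ^ (1 / α)` maps to a cover of `Z` at scale `δ`; the constant
  -- comes from raising that scale to the power `-q`.
  refine upperBoxDim_le_of_eventually (C := ((B : ℝ) ^ (1 / α)) ^ q) (div_nonneg hq0 hα.le) ?_
  filter_upwards [hlim.eventually (eventually_coveringNumber_le hq'), self_mem_nhdsWithin]
    with δ h1 hδ
  have hδ' : 0 < (δ : ℝ) := NNReal.coe_pos.2 hδ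
  have hB' : 0 < (B : ℝ) := NNReal.coe_pos.2 hB
  refine le_trans (ENat.toENNReal_le.2 (coveringNumber_univ_le_of_surjective hφ
    fun x y hxy => ?_)) (h1.trans (le_of_eq ?_))
  · refine (h x y).trans ?_
    rw [NNReal.coe_rpow, NNReal.coe_div] at hxy
    calc A * dist x y ^ α ≤ B * dist x y ^ α :=
          mul_le_mul_of_nonneg_right (le_max_left A 1) (Real.rpow_nonneg dist_nonneg _)
      _ ≤ B * (((δ : ℝ) / B) ^ (1 / α)) ^ α :=
          mul_le_mul_of_nonneg_left (Real.rpow_le_rpow dist_nonneg hxy hα.le) B.2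
      _ = δ := by
          rw [← Real.rpow_mul (by positivity), one_div_mul_cancel hα.ne', Real.rpow_one]
          field_simp
  · congr 1
    rw [NNReal.coe_rpow, NNReal.coe_div, Real.div_rpow hδ'.le hB'.le,
      Real.div_rpow (by positivity) (by positivity), ← Real.rpow_mul hδ'.le,
      Real.rpow_neg (by positivity : 0 ≤ (B : ℝ) ^ (1 / α)), div_inv_eq_mul, mul_comm]
    congr 2
    ring

end BoxDim

/-! ### Hölder functions -/

section Holder

variable {X : Type u} [MetricSpace X]

theorem abs_sub_le_h0Dist [PathConnectedSpace X] (f : C(X, ℝ)) (x y : X) :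
    |f x - f y| ≤ h0Dist f x y := by
  have h1 := passLevel_le_left f x y
  have h2 := (passLevel_symm_le f x y).trans (passLevel_le_left f y x)
  rw [abs_le, h0Dist]
  constructor <;> linarith

/-- The projection of `X` onto the tree `T_f`. -/
noncomputable def H0Tree.proj [PathConnectedSpace X] (f : C(X, ℝ)) (x : X) : H0Tree f :=
  SeparationQuotient.mk (X := H0Space f) x

theorem H0Tree.proj_surjective [PathConnectedSpace X] (f : C(X, ℝ)) :
    Function.Surjective (H0Tree.proj f) :=
  SeparationQuotient.surjective_mk (X := H0Space f)

theorem H0Tree.dist_proj [PathConnectedSpace X] (f : C(X, ℝ)) (x y : X) :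
    dist (H0Tree.proj f x) (H0Tree.proj f y) = h0Dist f x y :=
  SeparationQuotient.dist_mk (α := H0Space f) x y

theorem exists_eq_of_mem_Icc [CompactSpace X] [ConnectedSpace X] (f : C(X, ℝ)) :
    Icc (⨅ x, f x) (⨆ x, f x) ⊆ range f := by
  obtain ⟨m, -, hm⟩ := isCompact_univ.exists_isMinOn (s := (univ : Set X)) univ_nonempty
    f.continuous.continuousOn
  obtain ⟨M, -, hM⟩ := isCompact_univ.exists_isMaxOn (s := (univ : Set X)) univ_nonempty
    f.continuous.continuousOn
  refine (Icc_subset_Icc (le_ciInf fun x => hm (mem_univ x))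
    (ciSup_le fun x => hM (mem_univ x))).trans (intermediate_value_univ m M f.continuous)

/-- The short path is chosen before applying `e`, so no metric control of `e` is needed. With `M = K
* C ^ α * dist x y ^ α`, both `f (e y)` and the negative of twice the passing level cost multiples
of `M`, in total `3 * M`. -/
theorem upperBoxDim_h0Tree_le_of_holderWith [LLCSpace X] (f : C(X, ℝ)) {α K : ℝ≥0}
    (hα : 0 < α) (e : X ≃ₜ X) (h : HolderWith K α (f ∘ e)) :
    upperBoxDim (H0Tree f) ≤ 1 / (α : ℝ≥0∞) * upperBoxDim X := by
  obtain ⟨C, hC1, hC⟩ := LLCSpace.exists_path_dist_le (X := X)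
  rw [← ENNReal.ofReal_coe_nnreal (p := α)]
  have hα' : 0 < (α : ℝ) := NNReal.coe_pos.2 hα
  refine upperBoxDim_le_div_of_holder (φ := fun x => H0Tree.proj f (e x))
    (A := 3 * (K * C ^ (α : ℝ))) ?_ hα' fun x y => ?_
  · exact (H0Tree.proj_surjective f).comp e.surjective
  · rw [H0Tree.dist_proj]
    obtain ⟨γ, hγ⟩ := hC x y
    have hbound : ∀ z, dist x z ≤ C * dist x y →
        |f (e x) - f (e z)| ≤ K * C ^ (α : ℝ) * dist x y ^ (α : ℝ) := by
      intro z hz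
      have := h.dist_le_of_le hz
      rw [Real.dist_eq, Real.mul_rpow (by linarith) dist_nonneg, ← mul_assoc] at this
      exact this
    have hy := abs_le.1 (hbound y (le_mul_of_one_le_left dist_nonneg hC1))
    have hpass : f (e x) - K * C ^ (α : ℝ) * dist x y ^ (α : ℝ) ≤ passLevel f (e x) (e y) := by
      refine le_trans (le_ciInf fun t => ?_) (le_passLevel f (γ.map e.continuous))
      have := abs_le.1 (hbound (γ t) (hγ t))
      change _ ≤ f (e (γ t))
      linarith [this.2]
    rw [h0Dist]
    linarith [hy.1]

theorem upperBoxDim_h0Tree_le [CompactSpace X] [LLCSpace X] (f : C(X, ℝ))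
    (h : holderIndex f ≠ 0 ∨ upperBoxDim X ≠ ⊤) :
    upperBoxDim (H0Tree f) ≤ holderIndex f * upperBoxDim X := by
  rcases eq_or_ne (upperBoxDim X) ⊤ with htop | htop
  · rw [htop, ENNReal.mul_top (h.resolve_right fun h => h htop)]
    exact le_top
  rcases eq_or_ne (upperBoxDim X) 0 with h0 | h0
  -- Dividing by the dimension fails here. But the distance to a point is 1-Lipschitz and its range
  -- contains an interval if there are two points, so dimension `0` leaves a single point.
  · have hsub : ∀ x y : X, x = y := by
      intro x y
      by_contra hne
      let g : C(X, ℝ) := ⟨fun z => dist z x, continuous_id.dist continuous_const⟩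
      have hb : BddAbove (range g) := (isCompact_range g.continuous).bddAbove
      have hb' : BddBelow (range g) := (isCompact_range g.continuous).bddBelow
      have h1 : ⨅ z, g z ≤ 0 := (ciInf_le hb' x).trans (dist_self x).le
      have h2 : 0 < ⨆ z, g z := (dist_pos.2 (Ne.symm hne)).trans_le (le_ciSup hb y)
      have := one_le_upperBoxDim (Y := X) (g := g) (fun a b => abs_dist_sub_le a b x)
        (h1.trans_lt h2) (exists_eq_of_mem_Icc g)
      rw [h0] at this
      exact absurd this (by simp)
    have := upperBoxDim_h0Tree_le_of_holderWith f (α := 1) (K := 0) one_pos (Homeomorph.refl X)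
      (fun x y => by rw [hsub x y, edist_self]; exact zero_le)
    rw [h0, mul_zero] at this
    exact this.trans zero_le
  rw [← ENNReal.div_le_iff_le_mul (Or.inl h0) (Or.inl htop)]
  refine le_iInf fun α => le_iInf fun hα => le_iInf fun ⟨e, K, hK⟩ => ?_
  rw [ENNReal.div_le_iff_le_mul (Or.inl h0) (Or.inl htop)]
  exact upperBoxDim_h0Tree_le_of_holderWith f hα e hK

theorem one_le_upperBoxDim_h0Tree [CompactSpace X] [LLCSpace X] (f : C(X, ℝ))
    (h : ⨅ x, f x < ⨆ x, f x) : 1 ≤ upperBoxDim (H0Tree f) := by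
  have hdist : ∀ x y : X, |f x - f y| ≤ dist (H0Tree.proj f x) (H0Tree.proj f y) :=
    fun x y => (abs_sub_le_h0Dist f x y).trans (H0Tree.dist_proj f x y).ge
  choose g hg using H0Tree.proj_surjective f
  refine one_le_upperBoxDim (g := fun z => f (g z)) (fun z w => ?_) h fun t ht => ?_
  · have := hdist (g z) (g w)
    rwa [hg, hg] at this
  · obtain ⟨x, hx⟩ := exists_eq_of_mem_Icc f ht
    refine ⟨H0Tree.proj f x, ?_⟩
    have := hdist (g (H0Tree.proj f x)) x
    rw [hg, dist_self] at this
    exact (sub_eq_zero.1 (abs_nonpos_iff.1 this)).trans hx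

end Holder

/-! ### Covering numbers of the tree and superlevel ranks -/

section TreeCovering

variable {X : Type u} [MetricSpace X]

/-- The `j`-th level of the subdivision of `[inf f, sup f]` with mesh `ε`. -/
noncomputable def gridLevel (f : C(X, ℝ)) (ε : ℝ) (j : ℕ) : ℝ := (⨅ x, f x) + j * ε

/-- The number of intervals of length `ε` that fit into `[inf f, sup f]`. -/
noncomputable def gridSize (f : C(X, ℝ)) (ε : ℝ) : ℕ := ⌊((⨆ x, f x) - ⨅ x, f x) / ε⌋₊

/-- The sum of the superlevel ranks between consecutive levels of mesh `ε`. -/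
noncomputable def gridRank (k : Type v) [Field k] (f : C(X, ℝ)) (ε : ℝ) : ℕ :=
  ∑ j ∈ Finset.range (gridSize f ε),
    superlevelRank k f (gridLevel f ε (j + 1)) (gridLevel f ε j)

theorem gridLevel_zero (f : C(X, ℝ)) (ε : ℝ) : gridLevel f ε 0 = ⨅ x, f x := by
  simp [gridLevel]

theorem gridLevel_succ (f : C(X, ℝ)) (ε : ℝ) (j : ℕ) :
    gridLevel f ε (j + 1) = gridLevel f ε j + ε := by
  simp only [gridLevel]; push_cast; ring

theorem gridLevel_mono (f : C(X, ℝ)) {ε : ℝ} (hε : 0 ≤ ε) : Monotone (gridLevel f ε) :=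
  monotone_nat_of_le_succ fun j => by rw [gridLevel_succ]; linarith

theorem gridLevel_succ_le_iff (f : C(X, ℝ)) {ε : ℝ} (hε : 0 < ε) (j : ℕ) :
    gridLevel f ε (j + 1) ≤ ⨆ x, f x ↔ j < gridSize f ε := by
  rw [gridSize, ← Nat.add_one_le_iff, Nat.le_floor_iff', le_div_iff₀ hε, gridLevel]
  · constructor <;> intro h <;> linarith
  · omega

theorem exists_mem_gridLevel (f : C(X, ℝ)) {ε t : ℝ} (hε : 0 < ε) (ht : ⨅ x, f x ≤ t) :
    ∃ j, gridLevel f ε j ≤ t ∧ t < gridLevel f ε (j + 1) := by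
  refine ⟨⌊(t - ⨅ x, f x) / ε⌋₊, ?_, ?_⟩
  · have := Nat.floor_le (div_nonneg (sub_nonneg.2 ht) hε.le)
    rw [le_div_iff₀ hε] at this
    rw [gridLevel]; linarith
  · have := Nat.lt_floor_add_one ((t - ⨅ x, f x) / ε)
    rw [div_lt_iff₀ hε] at this
    rw [gridLevel]; push_cast; linarith

variable [CompactSpace X]

theorem iInf_le_apply (f : C(X, ℝ)) (x : X) : ⨅ z, f z ≤ f x :=
  ciInf_le (isCompact_range f.continuous).bddBelow x

theorem apply_le_iSup (f : C(X, ℝ)) (x : X) : f x ≤ ⨆ z, f z :=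
  le_ciSup (isCompact_range f.continuous).bddAbove x

variable [LLCSpace X]

theorem exists_isTransversal_gridLevel (f : C(X, ℝ)) {ε : ℝ} (hε : 0 < ε) :
    ∃ T : ℕ → Finset X,
      ∀ j, IsTransversal f (gridLevel f ε (j + 1)) (gridLevel f ε j) (T j) := by
  choose T hT using fun j : ℕ =>
    exists_isTransversal f (r := gridLevel f ε (j + 1)) (s := gridLevel f ε j)
      (by rw [gridLevel_succ]; linarith)
  exact ⟨T, fun j => (hT j).1⟩

theorem gridRank_eq_card (k : Type v) [Field k] (f : C(X, ℝ)) {ε : ℝ} (hε : 0 < ε)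
    {T : ℕ → Finset X}
    (hT : ∀ j, IsTransversal f (gridLevel f ε (j + 1)) (gridLevel f ε j) (T j)) :
    gridRank k f ε = ((Finset.range (gridSize f ε)).sigma T).card := by
  rw [Finset.card_sigma, gridRank]
  exact Finset.sum_congr rfl fun j _ =>
    (hT j).superlevelRank_eq k (by rw [gridLevel_succ]; linarith)

/-- Points between levels `j + 1` and `j + 2` joined to the same `t ∈ T j` at level `j` are within
`2 * 2ε` of each other. The strip below level `1` (label `none`) is one further class, as passing
levels are at least `inf f`; this is the `+ 1`. -/
theorem coveringNumber_h0Tree_le (k : Type v) [Field k] (f : C(X, ℝ)) {ε : ℝ≥0} (hε : 0 < ε) :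
    Metric.coveringNumber (4 * ε) (univ : Set (H0Tree f)) ≤ (gridRank k f ε + 1 : ℕ) := by
  have hε' : 0 < (ε : ℝ) := NNReal.coe_pos.2 hε
  obtain ⟨T, hT⟩ := exists_isTransversal_gridLevel f hε'
  let J : Finset (Option (Σ _ : ℕ, X)) :=
    Finset.insertNone ((Finset.range (gridSize f ε)).sigma T)
  have hJ : J.card = gridRank k f ε + 1 := by
    rw [Finset.card_insertNone, gridRank_eq_card k f hε' hT]
  have hcell : ∀ x, ∃ a ∈ J, (a = none → f x ≤ gridLevel f ε 1) ∧ ∀ j t, a = some ⟨j, t⟩ →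
      f x ≤ gridLevel f ε (j + 2) ∧ gridLevel f ε j ≤ passLevel f x t := by
    intro x
    obtain ⟨i, hi1, hi2⟩ := exists_mem_gridLevel f hε' (iInf_le_apply f x)
    rcases i with _ | j
    · exact ⟨none, Finset.none_mem_insertNone, fun _ => hi2.le, by simp⟩
    · obtain ⟨t, ht, hle⟩ := (hT j).exists_le x hi1
      refine ⟨some ⟨j, t⟩, Finset.some_mem_insertNone.2 (Finset.mem_sigma.2 ⟨?_, ht⟩), by simp, ?_⟩
      · exact Finset.mem_range.2 ((gridLevel_succ_le_iff f hε' j).1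
          (hi1.trans (apply_le_iSup f x)))
      · rintro j' t' h
        cases h
        exact ⟨hi2.le, hle⟩
  choose F hFJ hF0 hF using hcell
  have hdist : ∀ x y, F x = F y → h0Dist f x y ≤ 4 * ε := by
    intro x y hxy
    rcases ha : F x with _ | ⟨j, t⟩
    · have h1 := hF0 x ha
      have h2 := hF0 y (hxy ▸ ha)
      have h3 := iInf_le_passLevel f x y
      rw [gridLevel] at h1 h2
      rw [h0Dist]
      push_cast at h1 h2
      linarith
    · obtain ⟨h1, h2⟩ := hF x j t ha
      obtain ⟨h3, h4⟩ := hF y j t (hxy ▸ ha)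
      rw [passLevel_comm] at h4
      have h5 := le_passLevel_trans h2 h4
      rw [gridLevel_succ, gridLevel_succ] at h1 h3
      rw [h0Dist]
      linarith
  choose g hg using H0Tree.proj_surjective f
  refine (Metric.coveringNumber_le_packingNumber _ _).trans
    (iSup_le fun C => iSup_le fun _ => iSup_le fun hC => ?_)
  have hinj : InjOn (fun z => F (g z)) C := by
    intro z hz w hw hzw
    by_contra hne
    have h1 : ((4 * ε : ℝ≥0) : ℝ≥0∞) < edist z w := hC hz hw hne
    have h2 := hdist _ _ hzw
    rw [← H0Tree.dist_proj, hg, hg] at h2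
    rw [edist_nndist, ENNReal.coe_lt_coe] at h1
    have h3 : 4 * (ε : ℝ) < dist z w := by exact_mod_cast h1
    linarith
  rw [← hinj.encard_image, ← hJ, ← Set.encard_coe_eq_coe_finsetCard]
  refine Set.encard_le_encard ?_
  rintro _ ⟨z, -, rfl⟩
  exact hFJ _

/-- From each `t ∈ T j` descend to a point at level exactly `j + 1`. Two such points with the same
`j` have passing level below level `j`, hence distance over `2ε`; for different `j` their values
already differ by `ε`. -/
theorem gridRank_le_coveringNumber (k : Type v) [Field k] (f : C(X, ℝ)) {ε : ℝ≥0} (hε : 0 < ε) :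
    (gridRank k f ε : ℕ∞) ≤ Metric.coveringNumber (ε / 3) (univ : Set (H0Tree f)) := by
  have hε' : 0 < (ε : ℝ) := NNReal.coe_pos.2 hε
  obtain ⟨T, hT⟩ := exists_isTransversal_gridLevel f hε'
  obtain ⟨z, -, hz⟩ := isCompact_univ.exists_isMinOn (s := (univ : Set X)) univ_nonempty
    f.continuous.continuousOn
  have hz' : f z ≤ ⨅ x, f x := le_ciInf fun x => hz (mem_univ x)
  have hpt : ∀ a : Σ _ : ℕ, X, ∃ y, a.2 ∈ T a.1 →
      f y = gridLevel f ε (a.1 + 1) ∧ gridLevel f ε (a.1 + 1) ≤ passLevel f a.2 y := by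
    rintro ⟨j, t⟩
    by_cases ht : t ∈ T j
    · obtain ⟨y, hy⟩ := exists_eq_and_le_passLevel f ((hT j).le t ht)
        (hz'.trans ((gridLevel_zero f ε).ge.trans (gridLevel_mono f hε'.le (Nat.zero_le (j + 1)))))
      exact ⟨y, fun _ => hy⟩
    · exact ⟨z, fun h => absurd h ht⟩
  choose y hy using hpt
  have hsep : ∀ a ∈ (Finset.range (gridSize f ε)).sigma T,
      ∀ b ∈ (Finset.range (gridSize f ε)).sigma T, a ≠ b →
        (ε : ℝ) ≤ dist (H0Tree.proj f (y a)) (H0Tree.proj f (y b)) := by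
    rintro ⟨i, t⟩ ha ⟨j, u⟩ hb hne
    have ht := (Finset.mem_sigma.1 ha).2
    have hu := (Finset.mem_sigma.1 hb).2
    obtain ⟨h1, h2⟩ := hy ⟨i, t⟩ ht
    obtain ⟨h3, h4⟩ := hy ⟨j, u⟩ hu
    rw [H0Tree.dist_proj]
    by_cases hij : i = j
    · subst hij
      have hlt : passLevel f (y ⟨i, t⟩) (y ⟨i, u⟩) < gridLevel f ε i := by
        by_contra! hle
        have htu : t ≠ u := by rintro rfl; exact hne rfl
        have hmono : gridLevel f ε i ≤ gridLevel f ε (i + 1) :=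
          gridLevel_mono f hε'.le (Nat.le_succ i)
        rw [passLevel_comm] at h4
        exact absurd (le_passLevel_trans (hmono.trans h2) (le_passLevel_trans hle
          (hmono.trans h4))) (not_le.2 ((hT i).lt t ht u hu htu))
      rw [h0Dist, h1, h3]
      simp only [gridLevel_succ]
      linarith
    · refine le_trans ?_ (abs_sub_le_h0Dist f _ _)
      rw [h1, h3]
      simp only [gridLevel]
      have hij' : (1 : ℝ) ≤ |(i : ℝ) - j| := by
        have : (1 : ℤ) ≤ |(i : ℤ) - j| := Int.one_le_abs (by omega)
        exact_mod_cast this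
      have he : (⨅ x, f x) + ((i + 1 : ℕ) : ℝ) * ε - ((⨅ x, f x) + ((j + 1 : ℕ) : ℝ) * ε)
          = ((i : ℝ) - j) * ε := by push_cast; ring
      rw [he, abs_mul, abs_of_pos hε']
      exact le_mul_of_one_le_left hε'.le hij'
  let A : Set (Σ _ : ℕ, X) := ((Finset.range (gridSize f ε)).sigma T : Finset _)
  have hinj : InjOn (fun a => H0Tree.proj f (y a)) A := by
    intro a ha b hb hab
    by_contra hne
    have h1 := hsep a ha b hb hne
    rw [show H0Tree.proj f (y a) = H0Tree.proj f (y b) from hab, dist_self] at h1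
    linarith
  -- Separation is strict while the points are only at distance `≥ ε`; hence `2ε/3` rather than `ε`.
  have hsep' : Metric.IsSeparated ((2 * (ε / 3) : ℝ≥0) : ℝ≥0∞)
      ((fun a => H0Tree.proj f (y a)) '' A) := by
    rintro _ ⟨a, ha, rfl⟩ _ ⟨b, hb, rfl⟩ hne
    have h1 := hsep a ha b hb (by rintro rfl; exact hne rfl)
    rw [edist_nndist, ENNReal.coe_lt_coe, ← NNReal.coe_lt_coe, coe_nndist]
    push_cast
    linarith
  calc (gridRank k f ε : ℕ∞) = A.encard := by
        rw [gridRank_eq_card k f hε' hT, Set.encard_coe_eq_coe_finsetCard]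
    _ = ((fun a => H0Tree.proj f (y a)) '' A).encard := hinj.encard_image.symm
    _ ≤ Metric.packingNumber (2 * (ε / 3)) univ :=
        Metric.IsSeparated.encard_le_packingNumber (subset_univ _) hsep'
    _ ≤ _ := (Metric.packingNumber_two_mul_le_externalCoveringNumber _ _).trans
        (Metric.externalCoveringNumber_le_coveringNumber _ _)

end TreeCovering

/-! ### Bars and superlevel ranks -/

section BarSums

variable {X : Type u} [MetricSpace X]

/-- The length of the part of a finite bar that lies in `[inf f, sup f]`. -/
noncomputable def barLength (f : C(X, ℝ)) (b : ℝ × ℝ) : ℝ :=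
  min b.1 (⨆ x, f x) - max b.2 (⨅ x, f x)

theorem card_mul_le_barLength (f : C(X, ℝ)) {ε : ℝ} (hε : 0 < ε) {b : ℝ × ℝ} {A : Finset ℕ}
    (hne : A.Nonempty)
    (hA : ∀ j ∈ A, j < gridSize f ε ∧ gridLevel f ε (j + 1) ≤ b.1 ∧ b.2 < gridLevel f ε j) :
    A.card * ε ≤ barLength f b := by
  obtain ⟨-, -, h1⟩ := hA _ (A.min'_mem hne)
  obtain ⟨h2, h3, -⟩ := hA _ (A.max'_mem hne)
  have h4 : A.card ≤ A.max' hne + 1 - A.min' hne := by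
    refine (Finset.card_le_card (t := Finset.Icc (A.min' hne) (A.max' hne)) fun j hj => ?_).trans
      (Nat.card_Icc _ _).le
    exact Finset.mem_Icc.2 ⟨A.min'_le j hj, A.le_max' j hj⟩
  have h5 : (A.card : ℝ) + A.min' hne ≤ A.max' hne + 1 := by
    have h6 : A.min' hne ≤ A.max' hne := A.min'_le_max' hne
    exact_mod_cast (by omega : A.card + A.min' hne ≤ A.max' hne + 1)
  have h6 : gridLevel f ε (A.max' hne + 1) ≤ min b.1 (⨆ x, f x) :=
    le_min h3 ((gridLevel_succ_le_iff f hε _).2 h2)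
  have h7 : max b.2 (⨅ x, f x) ≤ gridLevel f ε (A.min' hne) :=
    max_le h1.le ((gridLevel_zero f ε).ge.trans (gridLevel_mono f hε.le (Nat.zero_le _)))
  have h8 : A.card * ε ≤ gridLevel f ε (A.max' hne + 1) - gridLevel f ε (A.min' hne) := by
    simp only [gridLevel]
    push_cast
    nlinarith
  rw [barLength]
  linarith

variable [CompactSpace X] [LLCSpace X]

/-- The `p`-th power sum of the lengths of the finite bars. -/
noncomputable def barPowerSum (k : Type v) [Field k] (f : C(X, ℝ)) (p : ℝ) : ℝ≥0∞ :=
  ∑' b : ℝ × ℝ, (barMult (superlevelRank k f) b.1 b.2 : ℝ≥0∞) * ENNReal.ofReal (barLength f b) ^ p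

open Classical in
theorem gridRank_le (k : Type v) [Field k] (f : C(X, ℝ)) {ε p : ℝ} (hε : 0 < ε) (hp : 1 ≤ p) :
    (gridRank k f ε : ℝ≥0∞) * ENNReal.ofReal ε ^ p ≤
      gridSize f ε * ENNReal.ofReal ε ^ p + barPowerSum k f p := by
  have hp0 : 0 ≤ p := zero_le_one.trans hp
  choose F hF hle using fun j : ℕ =>
    superlevelRank_le_sum k f (r := gridLevel f ε (j + 1)) (s := gridLevel f ε j)
      (by rw [gridLevel_succ]; linarith)
  let U : Finset (ℝ × ℝ) := (Finset.range (gridSize f ε)).biUnion F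
  let A : ℝ × ℝ → Finset ℕ := fun b => {j ∈ Finset.range (gridSize f ε) | b ∈ F j}
  have h1 : gridRank k f ε ≤ gridSize f ε +
      ∑ b ∈ U, (A b).card * barMult (superlevelRank k f) b.1 b.2 := by
    calc gridRank k f ε ≤ ∑ j ∈ Finset.range (gridSize f ε),
          (1 + ∑ b ∈ F j, barMult (superlevelRank k f) b.1 b.2) :=
        Finset.sum_le_sum fun j _ => hle j
      _ = gridSize f ε + ∑ j ∈ Finset.range (gridSize f ε),
          ∑ b ∈ F j, barMult (superlevelRank k f) b.1 b.2 := by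
        rw [Finset.sum_add_distrib]; simp
      _ = gridSize f ε + ∑ b ∈ U, ∑ j ∈ A b, barMult (superlevelRank k f) b.1 b.2 := by
        congr 1
        refine Finset.sum_comm' fun j b => ?_
        simp only [U, A, Finset.mem_biUnion, Finset.mem_filter]
        exact ⟨fun h => ⟨h, j, h⟩, fun h => h.1⟩
      _ = _ := by simp
  have h2 : ∀ b ∈ U, ((A b).card : ℝ≥0∞) * ENNReal.ofReal ε ^ p ≤
      ENNReal.ofReal (barLength f b) ^ p := by
    intro b _
    rcases (A b).eq_empty_or_nonempty with he | hne
    · simp [he]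
    · have h3 := card_mul_le_barLength f hε hne fun j hj => by
        obtain ⟨h4, h5⟩ := Finset.mem_filter.1 hj
        exact ⟨Finset.mem_range.1 h4, hF j b h5⟩
      -- Here `p ≥ 1` enters: `n ≤ n ^ p` for the number `n` of steps that count the bar.
      have h4 : (1 : ℝ≥0∞) ≤ ((A b).card : ℝ≥0∞) := by exact_mod_cast hne.card_pos
      calc ((A b).card : ℝ≥0∞) * ENNReal.ofReal ε ^ p
          ≤ ((A b).card : ℝ≥0∞) ^ p * ENNReal.ofReal ε ^ p := by
            gcongr
            exact ENNReal.le_rpow_self_of_one_le h4 hp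
        _ = ENNReal.ofReal ((A b).card * ε) ^ p := by
            rw [← ENNReal.mul_rpow_of_nonneg _ _ hp0, ENNReal.ofReal_mul (Nat.cast_nonneg _),
              ENNReal.ofReal_natCast]
        _ ≤ _ := ENNReal.rpow_le_rpow (ENNReal.ofReal_le_ofReal h3) hp0
  calc (gridRank k f ε : ℝ≥0∞) * ENNReal.ofReal ε ^ p
      ≤ ((gridSize f ε + ∑ b ∈ U, (A b).card * barMult (superlevelRank k f) b.1 b.2 : ℕ) : ℝ≥0∞)
          * ENNReal.ofReal ε ^ p := by gcongr
    _ = gridSize f ε * ENNReal.ofReal ε ^ p + ∑ b ∈ U,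
          (barMult (superlevelRank k f) b.1 b.2 : ℝ≥0∞) *
            (((A b).card : ℝ≥0∞) * ENNReal.ofReal ε ^ p) := by
        push_cast
        rw [add_mul, Finset.sum_mul]
        congr 1
        exact Finset.sum_congr rfl fun b _ => by ring
    _ ≤ gridSize f ε * ENNReal.ofReal ε ^ p + ∑ b ∈ U,
          (barMult (superlevelRank k f) b.1 b.2 : ℝ≥0∞) * ENNReal.ofReal (barLength f b) ^ p := by
        refine add_le_add le_rfl (Finset.sum_le_sum fun b hb => ?_)
        exact mul_le_mul_right (h2 b hb) _
    _ ≤ _ := add_le_add le_rfl (ENNReal.sum_le_tsum U)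

open Classical in
theorem tsum_barMult_le_gridRank (k : Type v) [Field k] (f : C(X, ℝ)) {ε : ℝ} (hε : 0 < ε) :
    ∑' b : ℝ × ℝ, (if 2 * ε < barLength f b then
      (barMult (superlevelRank k f) b.1 b.2 : ℝ≥0∞) else 0) ≤ gridRank k f ε := by
  have hj : ∀ b : ℝ × ℝ, ∃ j, 2 * ε < barLength f b →
      j < gridSize f ε ∧ gridLevel f ε (j + 1) < b.1 ∧ b.2 < gridLevel f ε j := by
    intro b
    by_cases h : 2 * ε < barLength f b
    -- The truncated lower end lies in step `i`, so step `i + 1` starts above it and ends at most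
    -- `2ε` above it, inside the bar.
    · obtain ⟨i, h1, h2⟩ := exists_mem_gridLevel f hε (le_max_right b.2 (⨅ x, f x))
      have h3 : gridLevel f ε (i + 1 + 1) < min b.1 (⨆ x, f x) := by
        rw [barLength] at h
        rw [gridLevel_succ, gridLevel_succ]
        linarith
      obtain ⟨h4, h5⟩ := lt_min_iff.1 h3
      exact ⟨i + 1, fun _ => ⟨(gridLevel_succ_le_iff f hε _).1 h5.le, h4,
        (le_max_left _ _).trans_lt h2⟩⟩
    · exact ⟨0, fun h' => absurd h' h⟩
  choose j hj using hj
  rw [ENNReal.tsum_eq_iSup_sum]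
  refine iSup_le fun F => ?_
  rw [← Finset.sum_filter, ← Nat.cast_sum]
  refine Nat.cast_le.2 ?_
  rw [← Finset.sum_fiberwise_of_maps_to (g := j) (t := Finset.range (gridSize f ε))]
  · refine Finset.sum_le_sum fun i _ => ?_
    refine sum_barMult_le k f (by rw [gridLevel_succ]; linarith) _ fun b hb => ?_
    obtain ⟨hbF, rfl⟩ := Finset.mem_filter.1 hb
    exact (hj b (Finset.mem_filter.1 hbF).2).2
  · intro b hb
    exact Finset.mem_range.2 (hj b (Finset.mem_filter.1 hb).2).1

end BarSums

/-! ### Power sums of lengths -/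

section PowerSums

theorem ENNReal.tsum_ne_top_of_eventually_le {u : ℕ → ℝ≥0∞} (hu : ∀ n, u n ≠ ⊤) {v : ℕ → ℝ}
    (hv : Summable v) (h : ∀ᶠ n in atTop, u n ≤ ENNReal.ofReal (v n)) : ∑' n, u n ≠ ⊤ := by
  have hs : Summable fun n => (u n).toReal := by
    refine Summable.of_norm_bounded_eventually_nat hv.norm ?_
    filter_upwards [h] with n hn
    rw [Real.norm_of_nonneg ENNReal.toReal_nonneg, Real.norm_eq_abs]
    exact (ENNReal.toReal_le_of_le_ofReal (abs_nonneg _)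
      (hn.trans (ENNReal.ofReal_le_ofReal (le_abs_self _))))
  have he : ∑' n, u n = ∑' n, ENNReal.ofReal (u n).toReal :=
    tsum_congr fun n => (ENNReal.ofReal_toReal (hu n)).symm
  rw [he, ← ENNReal.ofReal_tsum_of_nonneg (fun n => ENNReal.toReal_nonneg) hs]
  exact ENNReal.ofReal_ne_top

open Classical in
/-- A bound on the number of lengths above every level gives a bound on their power sums. -/
theorem tsum_mul_rpow_ne_top {β : Type*} (m : β → ℝ≥0∞) (L : β → ℝ) {O : ℝ} (hO : ∀ b, L b ≤ O)
    (hfin : ∀ ε > 0, ∑' b, (if ε < L b then m b else 0) ≠ ⊤) {C q p : ℝ} (hq : 0 ≤ q)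
    (hqp : q < p)
    (h : ∀ᶠ ε : ℝ in 𝓝[>] 0, ∑' b, (if ε < L b then m b else 0) ≤ ENNReal.ofReal (C * ε ^ (-q))) :
    ∑' b, m b * ENNReal.ofReal (L b) ^ p ≠ ⊤ := by
  have hp : 0 < p := hq.trans_lt hqp
  let N : ℝ → ℝ≥0∞ := fun ε => ∑' b, (if ε < L b then m b else 0)
  let a : ℕ → ℝ := fun n => (1 / 2) ^ n
  have ha : ∀ n, 0 < a n := fun n => by positivity
  -- Dyadic layers: a length in `(2^{-(n+1)}, 2^{-n}]` is bounded by `a n`, one above `1` by `O`.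
  -- The layers then sum to a geometric series of ratio `2^{-(p - q)}`.
  have hterm : ∀ b, m b * ENNReal.ofReal (L b) ^ p ≤
      (if 1 < L b then m b else 0) * ENNReal.ofReal O ^ p +
        ∑' n, (if a (n + 1) < L b then m b else 0) * ENNReal.ofReal (a n) ^ p := by
    intro b
    rcases le_or_gt (L b) 0 with h0 | h0
    · rw [ENNReal.ofReal_of_nonpos h0, ENNReal.zero_rpow_of_pos hp, mul_zero]
      exact zero_le
    rcases lt_or_ge 1 (L b) with h1 | h1
    · rw [if_pos h1]
      refine le_add_right ?_
      gcongr
      exact hO b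
    · obtain ⟨n, hn1, hn2⟩ := exists_nat_pow_near_of_lt_one h0 h1 (y := (1 / 2 : ℝ))
        (by norm_num) (by norm_num)
      refine le_add_left (le_trans ?_ (ENNReal.le_tsum n))
      rw [if_pos hn1]
      gcongr
  have hsum : ∑' b, m b * ENNReal.ofReal (L b) ^ p ≤
      N 1 * ENNReal.ofReal O ^ p + ∑' n, N (a (n + 1)) * ENNReal.ofReal (a n) ^ p := by
    refine (ENNReal.tsum_le_tsum hterm).trans (le_of_eq ?_)
    rw [ENNReal.tsum_add, ENNReal.tsum_mul_right, ENNReal.tsum_comm]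
    simp only [ENNReal.tsum_mul_right, N]
  have hpow : ∀ x : ℝ, ENNReal.ofReal x ^ p ≠ ⊤ := fun x =>
    ENNReal.rpow_ne_top_of_nonneg hp.le ENNReal.ofReal_ne_top
  refine ne_top_of_le_ne_top (ENNReal.add_ne_top.2
    ⟨ENNReal.mul_ne_top (hfin 1 one_pos) (hpow O), ?_⟩) hsum
  have hlt : (1 / 2 : ℝ) ^ (p - q) < 1 :=
    Real.rpow_lt_one (by norm_num) (by norm_num) (sub_pos.2 hqp)
  refine ENNReal.tsum_ne_top_of_eventually_le
    (fun n => ENNReal.mul_ne_top (hfin _ (ha _)) (hpow _))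
    (v := fun n => C * (1 / 2) ^ (-q) * ((1 / 2 : ℝ) ^ (p - q)) ^ n)
    ((summable_geometric_of_lt_one (by positivity) hlt).mul_left _) ?_
  have hlim : Tendsto (fun n => a (n + 1)) atTop (𝓝[>] 0) :=
    tendsto_nhdsWithin_iff.2 ⟨(tendsto_pow_atTop_nhds_zero_of_lt_one (by norm_num)
      (by norm_num)).comp (tendsto_add_atTop_nat 1), Eventually.of_forall fun n => ha _⟩
  filter_upwards [hlim.eventually h] with n hn
  refine (mul_le_mul_left hn _).trans (le_of_eq ?_)
  rw [ENNReal.ofReal_rpow_of_pos (ha n), ← ENNReal.ofReal_mul' (by positivity)]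
  congr 1
  have h1 : a (n + 1) ^ (-q) = (1 / 2) ^ (-q) * a n ^ (-q) := by
    rw [← Real.mul_rpow (by norm_num) (ha n).le]
    congr 1
    simp only [a, pow_succ, mul_comm]
  have h2 : ((1 / 2 : ℝ) ^ (p - q)) ^ n = a n ^ (-q) * a n ^ p := by
    rw [← Real.rpow_add (ha n), ← Real.rpow_natCast, ← Real.rpow_mul (by norm_num)]
    simp only [a]
    rw [← Real.rpow_natCast, ← Real.rpow_mul (by norm_num)]
    congr 1
    ring
  rw [h1, h2]
  ring

end PowerSums

/-! ### The persistence index -/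

section PersIndex

variable {X : Type u} [MetricSpace X] [CompactSpace X] [LLCSpace X]

theorem upperBoxDim_le_of_pers_lt_top (k : Type v) [Field k] (f : C(X, ℝ)) {p : ℝ} (hp : 1 ≤ p)
    (h : pers k f p < ⊤) : upperBoxDim (H0Tree f) ≤ ENNReal.ofReal p := by
  have hp0 : 0 < p := one_pos.trans_le hp
  have hP : barPowerSum k f p ≠ ⊤ := by
    rw [pers, ENNReal.rpow_lt_top_iff_of_pos (by positivity)] at h
    exact (ENNReal.add_lt_top.1 h).1.ne
  set P := (barPowerSum k f p).toReal
  have hP0 : 0 ≤ P := ENNReal.toReal_nonneg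
  set O := (⨆ x, f x) - ⨅ x, f x
  obtain ⟨x₀⟩ : Nonempty X := inferInstance
  have hO : 0 ≤ O := sub_nonneg.2 ((iInf_le_apply f x₀).trans (apply_le_iSup f x₀))
  -- After multiplication by `ε ^ p`, `1` bounds the extra class of the cover, `O` the term
  -- `gridSize` and `P` the finite bars; `4 ^ p` comes from the scale `4ε`.
  refine upperBoxDim_le_of_eventually (C := (1 + O + P) * 4 ^ p) hp0.le ?_
  filter_upwards [eventually_pos_lt_one] with δ hδ
  obtain ⟨ε, rfl⟩ : ∃ ε : ℝ≥0, δ = 4 * ε :=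
    ⟨δ / 4, by rw [mul_div_cancel₀ _ (by norm_num)]⟩
  have hδ1 : 0 < 4 * (ε : ℝ) := by exact_mod_cast hδ.1
  have hδ2 : 4 * (ε : ℝ) < 1 := by exact_mod_cast hδ.2
  have hε : 0 < (ε : ℝ) := by linarith
  have hε1 : (ε : ℝ) ≤ 1 := by linarith
  have h1 := gridRank_le k f hε hp
  have h2 : (gridRank k f ε : ℝ) * (ε : ℝ) ^ p ≤ gridSize f ε * (ε : ℝ) ^ p + P := by
    rw [← ENNReal.ofReal_toReal hP, ENNReal.ofReal_rpow_of_pos hε, ← ENNReal.ofReal_natCast,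
      ← ENNReal.ofReal_natCast, ← ENNReal.ofReal_mul (by positivity),
      ← ENNReal.ofReal_mul (by positivity), ← ENNReal.ofReal_add (by positivity) hP0] at h1
    exact (ENNReal.ofReal_le_ofReal_iff (by positivity)).1 h1
  have h3 : (gridSize f ε : ℝ) * (ε : ℝ) ^ p ≤ O := by
    have h4 : (gridSize f ε : ℝ) ≤ O / ε := Nat.floor_le (div_nonneg hO hε.le)
    rw [le_div_iff₀ hε] at h4
    refine le_trans (mul_le_mul_of_nonneg_left ?_ (Nat.cast_nonneg _)) h4
    exact (Real.rpow_le_rpow_of_exponent_ge hε hε1 hp).trans (Real.rpow_one _).le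
  have h5 : (ε : ℝ) ^ p ≤ 1 := Real.rpow_le_one hε.le hε1 hp0.le
  have h6 : ((gridRank k f ε + 1 : ℕ) : ℝ) ≤ (1 + O + P) * (ε : ℝ) ^ (-p) := by
    rw [Real.rpow_neg hε.le, ← div_eq_mul_inv, le_div_iff₀ (by positivity)]
    push_cast
    linarith
  calc ((Metric.coveringNumber (4 * ε) (univ : Set (H0Tree f)) : ℕ∞) : ℝ≥0∞)
      ≤ (((gridRank k f ε + 1 : ℕ) : ℕ∞) : ℝ≥0∞) :=
        ENat.toENNReal_le.2 (coveringNumber_h0Tree_le k f (NNReal.coe_pos.1 hε))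
    _ = ENNReal.ofReal ((gridRank k f ε + 1 : ℕ) : ℝ) := by
        rw [ENat.toENNReal_coe, ENNReal.ofReal_natCast]
    _ ≤ ENNReal.ofReal ((1 + O + P) * (ε : ℝ) ^ (-p)) := ENNReal.ofReal_le_ofReal h6
    _ = _ := by
        congr 1
        push_cast
        rw [Real.mul_rpow (by norm_num) hε.le, mul_assoc, ← mul_assoc (4 ^ p),
          ← Real.rpow_add (by norm_num), add_neg_cancel, Real.rpow_zero, one_mul]

theorem barPowerSum_ne_top (k : Type v) [Field k] (f : C(X, ℝ)) {q p : ℝ} (hq : 0 ≤ q)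
    (hqp : q < p) (h : upperBoxDim (H0Tree f) < ENNReal.ofReal q) : barPowerSum k f p ≠ ⊤ := by
  classical
  have hN : ∀ ε : ℝ, 0 < ε → ∑' b : ℝ × ℝ, (if ε < barLength f b then
      (barMult (superlevelRank k f) b.1 b.2 : ℝ≥0∞) else 0) ≤ gridRank k f (ε / 2) := by
    intro ε hε
    have := tsum_barMult_le_gridRank k f (half_pos hε)
    rwa [mul_div_cancel₀ ε two_ne_zero] at this
  refine tsum_mul_rpow_ne_top _ (barLength f) (O := (⨆ x, f x) - ⨅ x, f x)
    (fun b => sub_le_sub (min_le_right _ _) (le_max_right _ _))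
    (fun ε hε => ne_top_of_le_ne_top (ENNReal.natCast_ne_top _) (hN ε hε)) hq hqp
    -- Bars longer than `ε` are counted by `gridRank` at mesh `ε / 2`, hence by the covering number
    -- at scale `ε / 6`.
    (C := (1 / 6) ^ (-q)) ?_
  have hlim : Tendsto (fun ε : ℝ => (ε / 2).toNNReal / 3) (𝓝[>] 0) (𝓝[>] 0) := by
    refine tendsto_nhdsWithin_iff.2 ⟨?_, ?_⟩
    · have hc : Continuous fun ε : ℝ => (ε / 2).toNNReal / 3 := by fun_prop
      exact (hc.tendsto' 0 0 (by simp)).mono_left nhdsWithin_le_nhds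
    · filter_upwards [self_mem_nhdsWithin] with ε hε
      exact div_pos (Real.toNNReal_pos.2 (half_pos hε)) (by norm_num)
  filter_upwards [hlim.eventually (eventually_coveringNumber_le h), self_mem_nhdsWithin]
    with ε h1 hε
  have hε' : 0 < ε := hε
  have h2 := gridRank_le_coveringNumber k f (Real.toNNReal_pos.2 (half_pos hε'))
  rw [Real.coe_toNNReal _ (half_pos hε').le] at h2
  have h3 := ENat.toENNReal_le.2 h2
  rw [ENat.toENNReal_coe] at h3
  refine (hN ε hε').trans (h3.trans (h1.trans (le_of_eq ?_)))
  rw [NNReal.coe_div, Real.coe_toNNReal _ (half_pos hε').le,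
    ← Real.mul_rpow (by norm_num) hε'.le]
  congr 2
  push_cast
  ring

theorem pers_lt_top (k : Type v) [Field k] (f : C(X, ℝ)) {q p : ℝ} (hq : 0 ≤ q)
    (hqp : q < p) (h : upperBoxDim (H0Tree f) < ENNReal.ofReal q) : pers k f p < ⊤ := by
  have hp : 0 < p := hq.trans_lt hqp
  refine ENNReal.rpow_lt_top_of_nonneg (by positivity) (ENNReal.add_ne_top.2
    ⟨barPowerSum_ne_top k f hq hqp h, ?_⟩)
  rw [tsum_eq_single (⨆ x, f x) fun β hβ => by
    rw [essentialBarMult_eq_zero k f hβ, Nat.cast_zero, zero_mul]]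
  exact ENNReal.mul_ne_top (ENNReal.natCast_ne_top _)
    (ENNReal.rpow_ne_top_of_nonneg hp.le ENNReal.ofReal_ne_top)

theorem persIndex_eq_upperBoxDim (k : Type v) [Field k] (f : C(X, ℝ))
    (h : ∃ x y : X, f x ≠ f y) : persIndex k f = upperBoxDim (H0Tree f) := by
  have hlt : ⨅ x, f x < ⨆ x, f x := by
    obtain ⟨x, y, hxy⟩ := h
    rcases lt_or_gt_of_ne hxy with h | h
    · exact (iInf_le_apply f x).trans_lt (h.trans_le (apply_le_iSup f y))
    · exact (iInf_le_apply f y).trans_lt (h.trans_le (apply_le_iSup f x))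
  refine le_antisymm ?_ (le_iInf fun p => le_iInf fun hp => le_iInf fun h =>
    upperBoxDim_le_of_pers_lt_top k f hp h)
  refine le_of_forall_gt_imp_ge_of_dense fun p' hp' => ?_
  rcases eq_or_ne p' ⊤ with rfl | htop
  · exact le_top
  lift p' to ℝ≥0 using htop
  obtain ⟨q, h1, h2⟩ := ENNReal.lt_iff_exists_nnreal_btwn.1 hp'
  -- Nonconstancy matters here: it puts every exponent above the dimension in the range `p ≥ 1`.
  have hp1 : (1 : ℝ) ≤ p' := by
    have := (one_le_upperBoxDim_h0Tree f hlt).trans hp'.le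
    exact_mod_cast this
  have hqp : (q : ℝ) < p' := by exact_mod_cast h2
  rw [← ENNReal.ofReal_coe_nnreal] at h1
  refine (iInf_le_of_le (p' : ℝ) (iInf_le_of_le hp1 (iInf_le _ ?_))).trans
    (ENNReal.ofReal_coe_nnreal (p := p')).le
  exact pers_lt_top k f q.2 hqp h1

end PersIndex

theorem mainTheorem9 {X : Type u} [MetricSpace X] [CompactSpace X] [LLCSpace X]
    (k : Type v) [Field k] (f : C(X, ℝ)) :
    ((∃ x y : X, f x ≠ f y) → persIndex k f = upperBoxDim (H0Tree f)) ∧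
    ((holderIndex f ≠ 0 ∨ upperBoxDim X ≠ ⊤) →
      upperBoxDim (H0Tree f) ≤ holderIndex f * upperBoxDim X) :=
  ⟨persIndex_eq_upperBoxDim k f, upperBoxDim_h0Tree_le f⟩
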